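/- **Setting.** The cake is $[0,1]$; a piece is a finite union of disjoint intervals; an allocation $A=(A_1,\dots,A_n)$ consists of $n$ pairwise disjoint pieces, and is complete if $\bigcup_i A_i=[0,1]$. The valuations $V_1,\dots,V_n$ are non-atomic, additive, non-negative, with $V_i([0,1])=1$. $A$ is *proportional* if $V_i(A_i)\ge 1/n$ for all $i$; *$\varepsilon$-perfect* if $|V_i(A_j)-1/n|\le\varepsilon$ for all $i,j$; *$\delta$-CLB-$n$* if it is proportional and $\sum_{j\notin S}V_i(A_j)\le\frac{n-|S|}{n}(1+\delta)$ for all sets $S$ of agents with $|S|\ge2$ and all $i\in S$. Queries (Robertson–Webb model): $\mathrm{Eval}_i(I)$ returns $V_i(I)$; $\mathrm{Cut}_i(x,v)$ returns the smallest $y\in[x,1]$ with $V_i([x,y])=v$ (and $1$ if there is none). **Algorithm** (parameters $d\in\mathbb N$, $\varepsilon'>0$). It uses as a subroutine a query protocol $P$ that computes complete $\varepsilon'$-perfect allocations for $n+1$ agents, and an arbitrary valuation $V^+$. *Phase 1.* Let $S_1=\dots=S_n=\emptyset$, $R=[0,1]$. Repeat $d$ times: run $P$ for $(V_1,\dots,V_n,V^+)$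 with respect to, and normalized on, $R$ (the gaps of $R$ are removed; each query on $R$ is answered by actual queries and by the recorded values of the intervals that make up $R$; queries to $V^+$ are free), obtaining $B_1,\dots,B_{n+1}$; set $S_i\leftarrow S_i\cup B_i$ for $i\le n$, and $R\leftarrow B_{n+1}$. Whenever a new cut is made, the values of all agents for the two resulting intervals are determined by queries and recorded. *Phase 2.* While more than one agent is active, each active agent $i$ marks $R$ such that the part of $R$ to the left of the mark has value $1/n-\max_{B}V_i(B)$, the maximum being over the available pieces $B$ among $S_1,\dots,S_n$. The agent with the leftmost mark (ties broken arbitrarily) receives the part of $R$ to the left of her mark and a most valuable available piece, which are removed, and becomes inactive. The last agent receives the rest of $R$ and the last available piece. Put $L(n,\varepsilon)=\max\bigl\{1,\frac{\ln(1/\varepsilon)}{\ln n}\bigr\}$ (so $L(n,\varepsilon)=\frac{\ln(1/\varepsilon)}{\ln n}$ for $\varepsilon\le 1/n$). **Theorem.** (a) There is an absolute constant $\kappa$ such that for all $m\ge1$ and $0<\delta\le1$ some protocol computes complete $\delta$-perfect allocations for $m$ agents with at most $\kappa m^3/\delta$ queries, and with at most $\kappa m^2/\delta$ intervals in total. (b)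 There are functions $d(n,\varepsilon)=\Theta(L(n,\varepsilon))$ and $\varepsilon'(n,\varepsilon)=\Theta(\varepsilon/n^2)$, $\varepsilon'\le1$, with absolute constants, such that for every $\kappa$ there is a $K$ with the following property. For all $n\ge2$ and $0<\varepsilon\le1$, the algorithm with parameters $d(n,\varepsilon)$, $\varepsilon'(n,\varepsilon)$, with any subroutine $P$ that satisfies the bounds of (a) for $m=n+1$, $\delta=\varepsilon'(n,\varepsilon)$ and this $\kappa$, with any $V^+$ and any tie-breaking, computes for all valuations a complete, $\varepsilon$-perfect and proportional allocation, which is therefore $(\varepsilon n)$-CLB-$n$, and uses at most $K\,\frac{n^5}{\varepsilon}\,L(n,\varepsilon)$ $\mathrm{Cut}$ and $\mathrm{Eval}$ queries. (c) Consequently, there is an absolute constant $K$ such that for all $n\ge2$ and $0<\delta\le1$ some protocol computes complete $\delta$-CLB-$n$ allocations with at most $K\,\frac{n^6}{\delta}\,\frac{\ln(n/\delta)}{\ln n}$ queries. -/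

import Mathlib

namespace CakeCutting

/-! ### The cake, valuations, pieces and allocations -/

/-- A valuation of the cake `[0,1]`: normalized, additive and non-atomic, i.e. an atomless Borel
probability measure carried by `[0,1]`. -/
structure Valuation where
  measure : MeasureTheory.Measure ℝ
  nonatomic : MeasureTheory.NullSingletonClass measure
  normalized : measure (Set.Icc 0 1) = 1
  supported : measure (Set.Icc 0 1)ᶜ = 0

/-- The value of a part of the cake. -/
noncomputable def Valuation.value (V : Valuation) (s : Set ℝ) : ℝ := V.measure.real s

/-- The interval with end points `I.1 < I.2`. Intervals are half-open, `[a, b)`, except that an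
interval that ends at the right end `1` of the cake contains it, `[a, 1]`. -/
def intervalSet (I : ℝ × ℝ) : Set ℝ := {x | I.1 ≤ x ∧ (x < I.2 ∨ (x = 1 ∧ I.2 = 1))}

/-- A piece of cake: a finite collection of intervals (disjointness is `Piece.WellFormed`). -/
abbrev Piece := List (ℝ × ℝ)

/-- The part of the cake covered by a piece. -/
def Piece.toSet (p : Piece) : Set ℝ := {x | ∃ I ∈ p, x ∈ intervalSet I}

/-- The intervals of the piece are nondegenerate, lie in `[0,1]`, and are pairwise disjoint. -/
def Piece.WellFormed (p : Piece) : Prop :=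
  (∀ I ∈ p, 0 ≤ I.1 ∧ I.1 < I.2 ∧ I.2 ≤ 1) ∧
    p.Pairwise (fun I J => Disjoint (intervalSet I) (intervalSet J))

/-- An allocation: one piece per agent, pieces of different agents being disjoint. -/
def IsAllocation {n : ℕ} (A : Fin n → Piece) : Prop :=
  (∀ i, Piece.WellFormed (A i)) ∧
    ∀ i j, i ≠ j → Disjoint (Piece.toSet (A i)) (Piece.toSet (A j))

/-- The whole cake is allocated. -/
def IsComplete {n : ℕ} (A : Fin n → Piece) : Prop :=
  (⋃ i, Piece.toSet (A i)) = Set.Icc (0 : ℝ) 1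

/-- Every agent values her own piece at least `1 / n`. -/
def IsProportional {n : ℕ} (V : Fin n → Valuation) (A : Fin n → Piece) : Prop :=
  ∀ i, 1 / (n : ℝ) ≤ (V i).value (Piece.toSet (A i))

/-- Every agent values every piece at `1 / n` up to `ε`. -/
def IsPerfect {n : ℕ} (ε : ℝ) (V : Fin n → Valuation) (A : Fin n → Piece) : Prop :=
  ∀ i j, 1 / (n : ℝ) - ε ≤ (V i).value (Piece.toSet (A j)) ∧
    (V i).value (Piece.toSet (A j)) ≤ 1 / (n : ℝ) + ε

/-- `δ`-Complement Linearly Bounded-`k` allocations. -/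
def IsCLB {n : ℕ} (δ : ℝ) (k : ℕ) (V : Fin n → Valuation) (A : Fin n → Piece) : Prop :=
  IsProportional V A ∧
    ∀ S : Finset (Fin n), 2 ≤ S.card → S.card ≤ k → ∀ i ∈ S,
      ∑ j ∈ Sᶜ, (V i).value (Piece.toSet (A j)) ≤ ((n : ℝ) - S.card) / n * (1 + δ)

/-! ### The Robertson–Webb model -/

/-- The point of `[0,1]` closest to `x`. -/
noncomputable def clamp (x : ℝ) : unitInterval := Set.projIcc 0 1 zero_le_one x

/-- A deterministic adaptive protocol in the Robertson–Webb model, as a decision tree: either stop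
with an output, or put an `Eval` or a `Cut` query to an agent and continue depending on the
answer. Everything between two queries is free. -/
inductive Protocol (ι : Type) (α : Type) : Type
  | done (a : α) : Protocol ι α
  | eval (i : ι) (a b : unitInterval) (k : ℝ → Protocol ι α) : Protocol ι α
  | cut (i : ι) (x v : unitInterval) (k : unitInterval → Protocol ι α) : Protocol ι α

/-- The answer to the query `Eval([a, b])`. -/
noncomputable def Valuation.evalAnswer (V : Valuation) (a b : unitInterval) : ℝ :=
  V.value (Set.Icc (a : ℝ) b)

/-- The answer to the query `Cut(x, v)`: the smallest `y ∈ [x, 1]` with `V [x, y] = v`, and `1` if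
there is no such point. -/
noncomputable def Valuation.cutAnswer (V : Valuation) (x v : unitInterval) : unitInterval :=
  clamp (sInf (insert 1 {y : ℝ | (x : ℝ) ≤ y ∧ y ≤ 1 ∧ V.value (Set.Icc (x : ℝ) y) = v}))

namespace Protocol

/-- Run a protocol and continue with its output. -/
def bind {ι α β : Type} : Protocol ι α → (α → Protocol ι β) → Protocol ι β
  | done a, f => f a
  | eval i a b k, f => eval i a b (fun r => bind (k r) f)
  | cut i x v k, f => cut i x v (fun y => bind (k y) f)

instance {ι : Type} : Monad (Protocol ι) where
  pure := Protocol.done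
  bind := Protocol.bind

/-- The output of the protocol when the agents answer according to `V`. -/
noncomputable def run {ι α : Type} (V : ι → Valuation) : Protocol ι α → α
  | done a => a
  | eval i a b k => run V (k ((V i).evalAnswer a b))
  | cut i x v k => run V (k ((V i).cutAnswer x v))

/-- The number of `Eval` and `Cut` queries made when the agents answer according to `V`. -/
noncomputable def cost {ι α : Type} (V : ι → Valuation) : Protocol ι α → ℕ
  | done _ => 0
  | eval i a b k => cost V (k ((V i).evalAnswer a b)) + 1
  | cut i x v k => cost V (k ((V i).cutAnswer x v)) + 1

/-- The last agent is not a real one: her valuation `Vp` is known to the protocol, which answers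
all queries to her by itself. -/
noncomputable def answerLast {n : ℕ} {α : Type} (Vp : Valuation) :
    Protocol (Fin (n + 1)) α → Protocol (Fin n) α
  | done a => done a
  | eval i a b k =>
      if h : i = Fin.last n then answerLast Vp (k (Vp.evalAnswer a b))
      else eval (i.castPred h) a b (fun r => answerLast Vp (k r))
  | cut i x v k =>
      if h : i = Fin.last n then answerLast Vp (k (Vp.cutAnswer x v))
      else cut (i.castPred h) x v (fun y => answerLast Vp (k y))

/-- Obtain a number from each index in the list, one after the other. -/
def collect {ι κ : Type} [DecidableEq κ] (f : κ → Protocol ι ℝ) : List κ → Protocol ι (κ → ℝ)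
  | [] => done (fun _ => 0)
  | j :: l => do
      let r ← f j
      let g ← collect f l
      return Function.update g j r

end Protocol

/-! ### Non-contiguous cakes

The residue is a list of cells, ordered from left to right. The protocol keeps track of the value
of every agent for every cell. -/

/-- An interval of the cake, with the values of all agents for it that the protocol has
recorded. -/
structure Cell (m : ℕ) where
  left : ℝ
  right : ℝ
  known : Fin m → ℝ

/-- The piece of cake formed by a list of cells. -/
def cellsPiece {m : ℕ} (R : List (Cell m)) : Piece := R.map (fun c => (c.left, c.right))

/-- The recorded value of agent `i` for a list of cells. -/
def cellsValue {m : ℕ} (i : Fin m) (R : List (Cell m)) : ℝ := (R.map (fun c => c.known i)).sum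

/-- The residue as a cake of its own: the gaps are removed and the rest is rescaled to `[0,1]`.
`coord R x` is the new position of the point `x`, that is, the length of the part of `R` to the
left of `x`, divided by the length of `R`. -/
noncomputable def coord {m : ℕ} (R : List (Cell m)) (x : ℝ) : ℝ :=
  (R.map (fun c => max c.left (min x c.right) - c.left)).sum /
    (R.map (fun c => c.right - c.left)).sum

/-- The (leftmost) point of the original cake whose position in the rescaled residue is `s`. -/
noncomputable def point {m : ℕ} (R : List (Cell m)) (s : ℝ) : ℝ :=
  sInf {x : ℝ | 0 ≤ x ∧ x ≤ 1 ∧ s ≤ coord R x}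

/-- The value of agent `i` for the part of `R` to the left of `x`. At most one query. -/
noncomputable def leftValue {m : ℕ} (i : Fin m) (x : ℝ) : List (Cell m) → Protocol (Fin m) ℝ
  | [] => Protocol.done 0
  | c :: R =>
      if x ≤ c.left then Protocol.done 0
      else if x < c.right then Protocol.eval i (clamp c.left) (clamp x) Protocol.done
      else do
        let r ← leftValue i x R
        return c.known i + r

/-- Agent `i` makes a mark such that the part of `R` to the left of it has value `w`. At most one
query. (The mark is at `1` if `R` is worth less than `w`.) -/
noncomputable def mark {m : ℕ} (i : Fin m) : ℝ → List (Cell m) → Protocol (Fin m) ℝ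
  | _, [] => Protocol.done 1
  | w, c :: R =>
      if w ≤ c.known i then
        Protocol.cut i (clamp c.left) (clamp w) (fun y => Protocol.done (y : ℝ))
      else mark i (w - c.known i) R

/-- Run a protocol with respect to, and normalized on, the residue `R`: every query on the rescaled
residue is answered through queries on the original cake and the recorded values. -/
noncomputable def simulate {m : ℕ} {α : Type} (R : List (Cell m)) :
    Protocol (Fin m) α → Protocol (Fin m) α
  | .done a => .done a
  | .eval i s t k => do
      let p ← leftValue i (point R s) R
      let q ← leftValue i (point R t) R
      simulate R (k (max 0 ((q - p) / cellsValue i R)))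
  | .cut i s v k =>
      if v = 0 then simulate R (k s)
      else do
        let p ← leftValue i (point R s) R
        let x ← mark i (p + v * cellsValue i R) R
        simulate R (k (clamp (coord R x)))

/-- Cut the cell that has `x` in its interior, if there is one, and record the values of all agents
for the two parts. -/
noncomputable def splitAt {m : ℕ} (x : ℝ) : List (Cell m) → Protocol (Fin m) (List (Cell m))
  | [] => Protocol.done []
  | c :: R =>
      if c.left < x ∧ x < c.right then do
        let g ← Protocol.collect
          (fun i => Protocol.eval i (clamp c.left) (clamp x) Protocol.done) (List.finRange m)
        return (⟨c.left, x, g⟩ :: ⟨x, c.right, fun i => c.known i - g i⟩ :: R)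
      else do
        let R' ← splitAt x R
        return (c :: R')

/-- Cut at all points of a list. -/
noncomputable def splitAll {m : ℕ} : List ℝ → List (Cell m) → Protocol (Fin m) (List (Cell m))
  | [], R => Protocol.done R
  | x :: l, R => do
      let R' ← splitAt x R
      splitAll l R'

/-- All end points of the intervals of an allocation. -/
def endpoints {m : ℕ} (B : Fin m → Piece) : List ℝ :=
  (List.finRange m).flatMap (fun j => (B j).flatMap (fun I => [I.1, I.2]))

open Classical in
/-- The cells of `R'` (a refinement of `R`) that belong to the `j`-th piece of an allocation `B` of
the rescaled residue `R`. -/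
noncomputable def cellsOf {m : ℕ} (R R' : List (Cell m)) (B : Fin m → Piece) (j : Fin m) :
    List (Cell m) :=
  R'.filter (fun c => decide (coord R ((c.left + c.right) / 2) ∈ Piece.toSet (B j)))

/-! ### The algorithm -/

/-- First phase, `d` iterations: split the residue `R` by the protocol `P` for `n + 1` agents, add
the first `n` pieces to `S 0, …, S (n-1)`, and keep the last one as the new residue. -/
noncomputable def phaseOne {n : ℕ} (P : Protocol (Fin (n + 1)) (Fin (n + 1) → Piece)) :
    ℕ → (Fin n → List (Cell (n + 1))) → List (Cell (n + 1)) →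
      Protocol (Fin (n + 1)) ((Fin n → List (Cell (n + 1))) × List (Cell (n + 1)))
  | 0, S, R => Protocol.done (S, R)
  | d + 1, S, R => do
      let B ← simulate R P
      let R' ← splitAll ((endpoints B).map (point R)) R
      phaseOne P d (fun j => S j ++ cellsOf R R' B j.castSucc) (cellsOf R R' B (Fin.last n))

/-- `sel f T` is a minimizer of `f` on `T`; this is how ties are broken. -/
def IsSelector {n : ℕ} (sel : (Fin n → ℝ) → Finset (Fin n) → Fin n) : Prop :=
  ∀ f T, T.Nonempty → sel f T ∈ T ∧ ∀ j ∈ T, f (sel f T) ≤ f j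

/-- The index of a most valuable piece of agent `i` among the available ones. -/
noncomputable def favorite {n : ℕ} (sel : (Fin n → ℝ) → Finset (Fin n) → Fin n)
    (S : Fin n → List (Cell (n + 1))) (T : Finset (Fin n)) (i : Fin n) : Fin n :=
  sel (fun j => -cellsValue i.castSucc (S j)) T

/-- Second phase (cut-and-match Last Diminisher), with active agents `M`, indices `T` of the
available pieces, and residue `R`. The counter is the number of active agents minus one, so the
phase stops when a single agent is left. Every active agent marks the residue such that the part to
the left of the mark together with her favorite available piece has value `1 / n`; the agent with
the leftmost mark takes these two and leaves. The last agent takes all that remains. -/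
noncomputable def phaseTwo {n : ℕ} (sel : (Fin n → ℝ) → Finset (Fin n) → Fin n)
    (S : Fin n → List (Cell (n + 1))) :
    ℕ → Finset (Fin n) → Finset (Fin n) → List (Cell (n + 1)) →
      Protocol (Fin (n + 1)) (Fin n → Piece)
  | 0, M, T, R =>
      Protocol.done (fun i =>
        if i ∈ M then
          cellsPiece (R ++ ((List.finRange n).filter (fun j => j ∈ T)).flatMap S)
        else [])
  | k + 1, M, T, R => do
      let marks ← Protocol.collect
        (fun i : Fin n =>
          mark i.castSucc (1 / (n : ℝ) - cellsValue i.castSucc (S (favorite sel S T i))) R)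
        ((List.finRange n).filter (fun i => i ∈ M))
      let i₀ := sel marks M
      let j₀ := favorite sel S T i₀
      let R' ← splitAt (marks i₀) R
      let A ← phaseTwo sel S k (M.erase i₀) (T.erase j₀)
        (R'.filter (fun c => decide (¬ c.right ≤ marks i₀)))
      return Function.update A i₀
        (cellsPiece (R'.filter (fun c => decide (c.right ≤ marks i₀)) ++ S j₀))

/-- The two-phase algorithm for `n` agents, with number of iterations `d` of the first phase, an
`ε'`-perfect subroutine `P` for `n + 1` agents, and an arbitrary valuation `Vp` of the additional
agent. The residue starts as the whole cake, worth `1` to everybody. -/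
noncomputable def algorithm {n : ℕ} (P : Protocol (Fin (n + 1)) (Fin (n + 1) → Piece)) (d : ℕ)
    (Vp : Valuation) (sel : (Fin n → ℝ) → Finset (Fin n) → Fin n) :
    Protocol (Fin n) (Fin n → Piece) :=
  Protocol.answerLast Vp do
    let SR ← phaseOne P d (fun _ => []) [⟨0, 1, fun _ => 1⟩]
    phaseTwo sel SR.1 (n - 1) Finset.univ Finset.univ SR.2

/-- `P` computes complete `δ`-perfect allocations for `m` agents with `O(m³/δ)` queries and
`O(m²/δ)` intervals, with constant `κ`. -/
def IsPerfectSubroutine {m : ℕ} (κ δ : ℝ) (P : Protocol (Fin m) (Fin m → Piece)) : Prop :=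
  ∀ W : Fin m → Valuation,
    IsAllocation (P.run W) ∧ IsComplete (P.run W) ∧ IsPerfect δ W (P.run W) ∧
    (P.cost W : ℝ) ≤ κ * ((m : ℝ) ^ 3 / δ) ∧
    ((∑ j, (P.run W j).length : ℕ) : ℝ) ≤ κ * ((m : ℝ) ^ 2 / δ)

end CakeCutting

namespace CakeCutting

open MeasureTheory Set

/-! ### Running protocols -/

namespace Protocol

variable {ι α β : Type} (V : ι → Valuation)

/-! Write `q = 1/(n+1)` and let `δ` be the accuracy of the subroutine. In an iteration of the first
phase every agent values each of the `n + 1` parts of the residue at a fraction between `q - δ` and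
`q + δ` of what the residue is worth to her. After `d` iterations her value `ρ` for the residue
therefore lies between `(q - δ)^d` and `(q + δ)^d`. One iteration changes the difference between two
pieces `S j`, `S k` by at most `2δ` times the current residue. Since `q + δ ≤ 1/2`, that residue is
at most twice what it loses in the iteration, so these errors telescope to at most `4δ` in total. By
averaging, each `S j` is within `4δ` of `(1 - ρ)/n` (`IsPartialAllocation.run_phaseOne`,
`algorithm_spec`).

The depth `d` is chosen such that `4nδ ≤ ρ ≤ ε/2`. The lower bound gives `S j ≤ 1/n` for everybody,
so nobody starts the second phase with a surplus. The upper bound makes the second phase harmless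
for perfection: each agent gets some `S j` and a part of the residue. Such a `d` exists because
`(n+1)^d` can be placed between `4/ε` and `4(n+1)/ε`, while `δ` of order `ε/n²` keeps `(1 ±
(n+1)δ)^d` between `1/2` and `2` (`residue_bounds`).

Proportionality is a Last Diminisher argument (`IsSelector.run_phaseTwo`). While `k + 1` agents are
active, each of them values what is left at least at `(k+1)/n`. Hence each can complete her favorite
available piece to value `1/n`. The leaver takes the leftmost mark, so every other active agent
loses at most the part up to her own mark and a piece no better than her favorite, together at most
`1/n`.

The subroutine runs on a cake with gaps. Pushing the conditional measure on the residue forward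
along `coord` gives an honest `Valuation`, and `simulate` answers exactly as this valuation does,
with at most two actual queries each (`IsResidue.run_simulate`). Cutting at the end points of the
answer turns its pieces into lists of cells with correct recorded values (`Refines.value_cellsOf`).

The subroutine itself comes from discrepancy theory. Each of `m` agents makes `O(m/δ)` cuts, so that
every cell is worth at most `δ/(2m)` to everybody. The value vectors of the cells then have
`ℓ¹`-norm at most `δ/2`, and a multicolor Beck–Fiala theorem (`exists_balanced_coloring`)
distributes the cells to `m` agents with error at most `δ`. Finding the coloring costs no queries;
recording `m` values for `O(m²/δ)` cuts costs `O(m³/δ)`. -/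

@[simp] theorem run_done (a : α) : run V (done a : Protocol ι α) = a := rfl

@[simp] theorem cost_done (a : α) : cost V (done a : Protocol ι α) = 0 := rfl

@[simp] theorem run_pure (a : α) : run V (pure a : Protocol ι α) = a := rfl

@[simp] theorem cost_pure (a : α) : cost V (pure a : Protocol ι α) = 0 := rfl

@[simp] theorem run_eval (i : ι) (a b : unitInterval) (k : ℝ → Protocol ι α) :
    run V (eval i a b k) = run V (k ((V i).evalAnswer a b)) := rfl

@[simp] theorem cost_eval (i : ι) (a b : unitInterval) (k : ℝ → Protocol ι α) :
    cost V (eval i a b k) = cost V (k ((V i).evalAnswer a b)) + 1 := rfl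

@[simp] theorem run_cut (i : ι) (x v : unitInterval) (k : unitInterval → Protocol ι α) :
    run V (cut i x v k) = run V (k ((V i).cutAnswer x v)) := rfl

@[simp] theorem cost_cut (i : ι) (x v : unitInterval) (k : unitInterval → Protocol ι α) :
    cost V (cut i x v k) = cost V (k ((V i).cutAnswer x v)) + 1 := rfl

@[simp] theorem run_bind (p : Protocol ι α) (f : α → Protocol ι β) :
    run V (p >>= f) = run V (f (run V p)) := by
  change run V (Protocol.bind p f) = _
  induction p with
  | done a => rfl
  | eval i a b k ih => exact ih _
  | cut i x v k ih => exact ih _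

@[simp] theorem cost_bind (p : Protocol ι α) (f : α → Protocol ι β) :
    cost V (p >>= f) = cost V p + cost V (f (run V p)) := by
  change cost V (Protocol.bind p f) = _
  induction p with
  | done a => simp [Protocol.bind]
  | eval i a b k ih => simp only [Protocol.bind, cost_eval, run_eval, ih]; ring
  | cut i x v k ih => simp only [Protocol.bind, cost_cut, run_cut, ih]; ring

theorem run_collect {κ : Type} [DecidableEq κ] (f : κ → Protocol ι ℝ) (l : List κ) {j : κ}
    (hj : j ∈ l) : run V (collect f l) j = run V (f j) := by
  induction l with
  | nil => simp at hj
  | cons a l ih =>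
    simp only [collect, run_bind, run_pure]
    by_cases h : j = a
    · subst h; simp
    · rw [Function.update_of_ne h]
      exact ih ((List.mem_cons.1 hj).resolve_left h)

theorem cost_collect_le {κ : Type} [DecidableEq κ] (f : κ → Protocol ι ℝ) (l : List κ) {b : ℕ}
    (hb : ∀ j ∈ l, cost V (f j) ≤ b) : cost V (collect f l) ≤ l.length * b := by
  induction l with
  | nil => simp [collect]
  | cons a l ih =>
    simp only [collect, cost_bind, cost_pure, List.length_cons]
    have h1 := hb a (by simp)
    have h2 := ih (fun j hj => hb j (by simp [hj]))
    nlinarith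

/-- The valuations of all agents when the valuation of the last one is `Vp`. -/
noncomputable def withLast {n : ℕ} (V : Fin n → Valuation) (Vp : Valuation) :
    Fin (n + 1) → Valuation :=
  Fin.snoc (α := fun _ => Valuation) V Vp

@[simp] theorem withLast_last {n : ℕ} (V : Fin n → Valuation) (Vp : Valuation) :
    withLast V Vp (Fin.last n) = Vp := by simp [withLast]

@[simp] theorem withLast_castSucc {n : ℕ} (V : Fin n → Valuation) (Vp : Valuation) (i : Fin n) :
    withLast V Vp i.castSucc = V i := by simp [withLast]

theorem withLast_of_ne {n : ℕ} (V : Fin n → Valuation) (Vp : Valuation) {i : Fin (n + 1)}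
    (h : i ≠ Fin.last n) : withLast V Vp i = V (i.castPred h) := by
  conv_lhs => rw [← Fin.castSucc_castPred i h]
  simp only [withLast_castSucc]

theorem run_answerLast {n : ℕ} (V : Fin n → Valuation) (Vp : Valuation)
    (p : Protocol (Fin (n + 1)) α) :
    run V (answerLast Vp p) = run (withLast V Vp) p := by
  induction p with
  | done a => rfl
  | eval i a b k ih =>
    by_cases h : i = Fin.last n
    · subst h; simp [answerLast, ih]
    · simp [answerLast, h, ih, withLast_of_ne V Vp h]
  | cut i x v k ih =>
    by_cases h : i = Fin.last n
    · subst h; simp [answerLast, ih]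
    · simp [answerLast, h, ih, withLast_of_ne V Vp h]

theorem cost_answerLast_le {n : ℕ} (V : Fin n → Valuation) (Vp : Valuation)
    (p : Protocol (Fin (n + 1)) α) :
    cost V (answerLast Vp p) ≤ cost (withLast V Vp) p := by
  induction p with
  | done a => rfl
  | eval i a b k ih =>
    by_cases h : i = Fin.last n
    · subst h
      simpa [answerLast] using (ih _).trans (Nat.le_succ _)
    · simpa [answerLast, h, withLast_of_ne V Vp h] using ih _
  | cut i x v k ih =>
    by_cases h : i = Fin.last n
    · subst h
      simpa [answerLast] using (ih _).trans (Nat.le_succ _)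
    · simpa [answerLast, h, withLast_of_ne V Vp h] using ih _

end Protocol

/-! ### Valuations -/

namespace Valuation

variable (V : Valuation)

instance : NullSingletonClass V.measure := V.nonatomic

instance : IsProbabilityMeasure V.measure := by
  refine ⟨?_⟩
  rw [← Set.union_compl_self (Icc (0 : ℝ) 1),
    measure_union disjoint_compl_right measurableSet_Icc.compl, V.normalized, V.supported, add_zero]

/-- The value of the part of the cake to the left of `x`. -/
noncomputable def cdf (x : ℝ) : ℝ := V.value (Iic x)

theorem value_nonneg (s : Set ℝ) : 0 ≤ V.value s := measureReal_nonneg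

theorem value_mono {s t : Set ℝ} (h : s ⊆ t) : V.value s ≤ V.value t := measureReal_mono h

theorem value_union {s t : Set ℝ} (h : Disjoint s t) (ht : MeasurableSet t) :
    V.value (s ∪ t) = V.value s + V.value t := measureReal_union h ht

@[simp] theorem value_empty : V.value ∅ = 0 := measureReal_empty

theorem value_unit : V.value (Icc 0 1) = 1 := by
  simp [value, measureReal_def, V.normalized]

theorem cdf_mono : Monotone V.cdf := fun _ _ h => V.value_mono (Iic_subset_Iic.2 h)

/-- A jump of a distribution function is an atom of the measure. This is the form in which
non-atomicity lets the intermediate value theorem answer `Cut` queries. -/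
theorem cdf_continuous : Continuous V.cdf := by
  have hf : V.cdf = ProbabilityTheory.cdf V.measure := by
    funext x; rw [ProbabilityTheory.cdf_eq_real]; rfl
  rw [hf, continuous_iff_continuousAt]
  intro x
  rw [(ProbabilityTheory.monotone_cdf _).continuousAt_iff_leftLim_eq_rightLim,
    StieltjesFunction.rightLim_eq]
  have h : (ProbabilityTheory.cdf V.measure).measure {x} = 0 := by
    rw [ProbabilityTheory.measure_cdf]; exact measure_singleton x
  rw [StieltjesFunction.measure_singleton, ENNReal.ofReal_eq_zero] at h
  exact le_antisymm ((ProbabilityTheory.monotone_cdf _).leftLim_le le_rfl) (by linarith)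

theorem value_Ioc {a b : ℝ} (h : a ≤ b) : V.value (Ioc a b) = V.cdf b - V.cdf a := by
  rw [cdf, cdf, ← Iic_union_Ioc_eq_Iic h, V.value_union _ measurableSet_Ioc]
  · ring
  · exact disjoint_left.2 fun x hx hx' => not_lt.2 hx hx'.1

theorem value_congr {s t : Set ℝ} (h : s =ᵐ[V.measure] t) : V.value s = V.value t :=
  measureReal_congr h

theorem value_Icc {a b : ℝ} (h : a ≤ b) : V.value (Icc a b) = V.cdf b - V.cdf a := by
  rw [← V.value_Ioc h]; exact V.value_congr Ioc_ae_eq_Icc.symm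

theorem value_Ioo {a b : ℝ} (h : a ≤ b) : V.value (Ioo a b) = V.cdf b - V.cdf a := by
  rw [← V.value_Ioc h]; exact V.value_congr Ioo_ae_eq_Ioc

theorem cdf_zero : V.cdf 0 = 0 := by
  refine le_antisymm ?_ (V.value_nonneg _)
  have : V.value (Iic 0) = V.value (Iio 0) := V.value_congr Iio_ae_eq_Iic.symm
  rw [cdf, this]
  have h : V.value (Iio 0) ≤ V.value (Icc 0 1)ᶜ :=
    V.value_mono fun x hx hx' => not_lt.2 hx'.1 hx
  simpa [value, measureReal_def, V.supported] using h

theorem cdf_one : V.cdf 1 = 1 := by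
  have := V.value_Icc zero_le_one
  rw [V.value_unit, V.cdf_zero] at this
  linarith

/-- Only the two end points can make a difference, and they are null. This makes the half-open
convention for intervals irrelevant to values. -/
theorem value_eq_of_Ioo {a b : ℝ} {s t : Set ℝ} (hs : s ⊆ Icc a b) (ht : t ⊆ Icc a b)
    (h : ∀ x ∈ Ioo a b, x ∈ s ↔ x ∈ t) : V.value s = V.value t := by
  refine V.value_congr (Filter.eventuallyEq_set.2 ?_)
  have hab : ∀ᵐ x ∂V.measure, x ≠ a ∧ x ≠ b := by
    refine Filter.Eventually.and ?_ ?_ <;>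
    · rw [ae_iff]; simp
  filter_upwards [hab] with x hx
  constructor
  · intro hxs
    have := hs hxs
    exact (h x ⟨lt_of_le_of_ne this.1 (Ne.symm hx.1), lt_of_le_of_ne this.2 hx.2⟩).1 hxs
  · intro hxs
    have := ht hxs
    exact (h x ⟨lt_of_le_of_ne this.1 (Ne.symm hx.1), lt_of_le_of_ne this.2 hx.2⟩).2 hxs

theorem coe_clamp {x : ℝ} (h0 : 0 ≤ x) (h1 : x ≤ 1) : (clamp x : ℝ) = x := by
  simp [clamp, projIcc, h0, h1]

@[simp] theorem clamp_coe (x : unitInterval) : clamp x = x := by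
  simp [clamp]

theorem evalAnswer_eq (a b : unitInterval) :
    V.evalAnswer a b = max 0 (V.cdf b - V.cdf a) := by
  unfold evalAnswer
  rcases le_or_gt (a : ℝ) b with h | h
  · rw [V.value_Icc h, max_eq_right (sub_nonneg.2 (V.cdf_mono h))]
  · rw [Icc_eq_empty (not_le.2 h), value_empty, max_eq_left (sub_nonpos.2 (V.cdf_mono h.le))]

/-- The answer to a `Cut` query when the remaining cake has enough value. -/
theorem cutAnswer_spec (x v : unitInterval) (h : V.cdf x + v ≤ 1) :
    x ≤ V.cutAnswer x v ∧ V.cdf (V.cutAnswer x v) = V.cdf x + v ∧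
      ∀ z : ℝ, x ≤ z → z ≤ 1 → V.cdf z = V.cdf x + v → (V.cutAnswer x v : ℝ) ≤ z := by
  set s := {y : ℝ | (x : ℝ) ≤ y ∧ y ≤ 1 ∧ V.value (Icc (x : ℝ) y) = v} with hs
  have hs' : s = Icc (x : ℝ) 1 ∩ V.cdf ⁻¹' {V.cdf x + v} := by
    ext y
    simp only [hs, mem_ofPred_eq, mem_inter_iff, mem_Icc, mem_preimage, mem_singleton_iff]
    constructor
    · rintro ⟨h1, h2, h3⟩
      rw [V.value_Icc h1] at h3
      exact ⟨⟨h1, h2⟩, by linarith⟩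
    · rintro ⟨⟨h1, h2⟩, h3⟩
      exact ⟨h1, h2, by rw [V.value_Icc h1]; linarith⟩
  have hne : s.Nonempty := by
    have := intermediate_value_Icc x.2.2 V.cdf_continuous.continuousOn
    obtain ⟨y, hy, hy'⟩ := this (show V.cdf x + v ∈ Icc _ _ from
      ⟨by linarith [v.2.1], by rw [V.cdf_one]; exact h⟩)
    exact ⟨y, by rw [hs']; exact ⟨hy, hy'⟩⟩
  have hcl : IsClosed s := by
    rw [hs']; exact isClosed_Icc.inter (isClosed_singleton.preimage V.cdf_continuous)
  have hbd : BddBelow s := ⟨x, fun y hy => hy.1⟩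
  have hmem : sInf s ∈ s := hcl.csInf_mem hne hbd
  -- The default answer `1` does not interfere, since `s` has a member that is at most `1`.
  have hins : sInf (insert 1 s) = sInf s := by
    rw [csInf_insert hbd hne]; exact min_eq_right hmem.2.1
  have hval : (V.cutAnswer x v : ℝ) = sInf s := by
    rw [cutAnswer, hins, coe_clamp (x.2.1.trans hmem.1) hmem.2.1]
  have hmem2 := (Set.ext_iff.1 hs' _).1 hmem
  refine ⟨?_, ?_, ?_⟩
  · rw [← Subtype.coe_le_coe, hval]; exact hmem.1
  · rw [hval]; exact hmem2.2
  · intro z h1 h2 h3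
    rw [hval]
    exact csInf_le hbd (by rw [hs']; exact ⟨⟨h1, h2⟩, h3⟩)

/-- The answer to a `Cut` query when the remaining cake is not valuable enough. -/
theorem cutAnswer_eq_one (x v : unitInterval) (h : 1 < V.cdf x + v) : V.cutAnswer x v = 1 := by
  have : {y : ℝ | (x : ℝ) ≤ y ∧ y ≤ 1 ∧ V.value (Icc (x : ℝ) y) = v} = ∅ := by
    ext y
    simp only [mem_ofPred_eq, mem_empty_iff_false, iff_false, not_and]
    intro h1 h2 h3
    rw [V.value_Icc h1] at h3
    have := V.cdf_mono h2
    rw [V.cdf_one] at this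
    linarith
  rw [cutAnswer, this]
  simp only [insert_empty_eq, csInf_singleton]
  exact clamp_coe 1

/-- A `Cut` query is answered correctly by `y` if `y` is the least point with enough value. -/
theorem cutAnswer_eq {x v y : unitInterval} (hxy : x ≤ y) (h : V.cdf y = V.cdf x + v)
    (hmin : ∀ z : ℝ, x ≤ z → z ≤ 1 → V.cdf z = V.cdf x + v → (y : ℝ) ≤ z) :
    V.cutAnswer x v = y := by
  have hy := V.cdf_mono y.2.2
  rw [V.cdf_one, h] at hy
  obtain ⟨h1, h2, h3⟩ := V.cutAnswer_spec x v hy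
  exact Subtype.ext (le_antisymm (h3 y hxy y.2.2 h) (hmin _ h1 (V.cutAnswer x v).2.2 h2))

end Valuation

/-! ### Intervals and pieces -/

theorem Ioo_subset_intervalSet (I : ℝ × ℝ) : Ioo I.1 I.2 ⊆ intervalSet I :=
  fun _ hx => ⟨hx.1.le, Or.inl hx.2⟩

theorem intervalSet_subset_Icc (I : ℝ × ℝ) : intervalSet I ⊆ Icc I.1 I.2 := by
  rintro x ⟨h1, h2 | ⟨h2, h3⟩⟩
  · exact ⟨h1, h2.le⟩
  · exact ⟨h1, by rw [h2, h3]⟩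

theorem measurableSet_intervalSet (I : ℝ × ℝ) : MeasurableSet (intervalSet I) := by
  have : intervalSet I = Ici I.1 ∩ (Iio I.2 ∪ ({1} ∩ {_x | I.2 = 1})) := by
    ext x; simp [intervalSet]
  rw [this]
  exact measurableSet_Ici.inter (measurableSet_Iio.union
    ((measurableSet_singleton 1).inter (MeasurableSet.const _)))

theorem intervalSet_eq_union {l x r : ℝ} (h1 : l < x) (h2 : x < r) (h3 : r ≤ 1) :
    intervalSet (l, r) = intervalSet (l, x) ∪ intervalSet (x, r) := by
  ext y
  simp only [intervalSet, mem_union, mem_ofPred_eq]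
  constructor
  · rintro ⟨h, h'⟩
    rcases lt_or_ge y x with hy | hy
    · exact Or.inl ⟨h, Or.inl hy⟩
    · exact Or.inr ⟨hy, h'⟩
  · rintro (⟨h, h' | ⟨h', h''⟩⟩ | ⟨h, h'⟩)
    · exact ⟨h, Or.inl (h'.trans h2)⟩
    · linarith
    · exact ⟨by linarith, h'⟩

theorem disjoint_intervalSet {I J : ℝ × ℝ} (h : I.2 ≤ J.1) (hJ : J.1 < J.2) (hJ' : J.2 ≤ 1) :
    Disjoint (intervalSet I) (intervalSet J) := by
  refine disjoint_left.2 ?_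
  rintro x ⟨-, hx | ⟨hx, hx'⟩⟩ ⟨hy, -⟩ <;> linarith

@[simp] theorem toSet_nil : Piece.toSet [] = ∅ := by ext; simp [Piece.toSet]

@[simp] theorem toSet_cons (I : ℝ × ℝ) (p : Piece) :
    Piece.toSet (I :: p) = intervalSet I ∪ Piece.toSet p := by
  ext; simp [Piece.toSet]

@[simp] theorem toSet_append (p q : Piece) :
    Piece.toSet (p ++ q) = Piece.toSet p ∪ Piece.toSet q := by
  ext; simp [Piece.toSet, or_and_right, exists_or]

theorem measurableSet_toSet (p : Piece) : MeasurableSet (Piece.toSet p) := by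
  induction p with
  | nil => simp
  | cons I p ih => rw [toSet_cons]; exact (measurableSet_intervalSet I).union ih

theorem value_toSet_inter (V : Valuation) {p : Piece}
    (hp : p.Pairwise (fun I J => Disjoint (intervalSet I) (intervalSet J)))
    {A : Set ℝ} (hA : MeasurableSet A) :
    V.value (Piece.toSet p ∩ A) = (p.map (fun I => V.value (intervalSet I ∩ A))).sum := by
  induction p with
  | nil => simp
  | cons I p ih =>
    rw [List.pairwise_cons] at hp
    rw [toSet_cons, union_inter_distrib_right, V.value_union _ ((measurableSet_toSet p).inter hA),
      ih hp.2, List.map_cons, List.sum_cons]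
    refine Disjoint.mono inter_subset_left inter_subset_left (disjoint_left.2 ?_)
    rintro x hx ⟨J, hJ, hxJ⟩
    exact disjoint_left.1 (hp.1 J hJ) hx hxJ

/-! ### Cells with recorded values -/

variable {m : ℕ}

/-- A nondegenerate interval of the cake whose recorded values are the true ones. -/
structure Cell.IsCorrect (V : Fin m → Valuation) (c : Cell m) : Prop where
  nonneg : 0 ≤ c.left
  lt : c.left < c.right
  le_one : c.right ≤ 1
  known : ∀ i, c.known i = (V i).cdf c.right - (V i).cdf c.left

/-- The set of points of a list of cells. -/
def cellsSet (R : List (Cell m)) : Set ℝ := Piece.toSet (cellsPiece R)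

@[simp] theorem cellsSet_nil : cellsSet ([] : List (Cell m)) = ∅ := toSet_nil

@[simp] theorem cellsSet_cons (c : Cell m) (R : List (Cell m)) :
    cellsSet (c :: R) = intervalSet (c.left, c.right) ∪ cellsSet R := toSet_cons _ _

@[simp] theorem cellsSet_append (R R' : List (Cell m)) :
    cellsSet (R ++ R') = cellsSet R ∪ cellsSet R' := by
  simp [cellsSet, cellsPiece]

theorem mem_cellsSet {R : List (Cell m)} {x : ℝ} :
    x ∈ cellsSet R ↔ ∃ c ∈ R, x ∈ intervalSet (c.left, c.right) := by
  simp [cellsSet, cellsPiece, Piece.toSet]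

theorem measurableSet_cellsSet (R : List (Cell m)) : MeasurableSet (cellsSet R) :=
  measurableSet_toSet _

theorem cellsSet_mono {R R' : List (Cell m)} (h : R ⊆ R') : cellsSet R ⊆ cellsSet R' := by
  intro x hx
  obtain ⟨c, hc, hx⟩ := mem_cellsSet.1 hx
  exact mem_cellsSet.2 ⟨c, h hc, hx⟩

/-- Correct cells that are pairwise disjoint. -/
structure IsCells (V : Fin m → Valuation) (R : List (Cell m)) : Prop where
  correct : ∀ c ∈ R, c.IsCorrect V
  disjoint : R.Pairwise fun c c' =>
    Disjoint (intervalSet (c.left, c.right)) (intervalSet (c'.left, c'.right))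

/-- Correct cells that are ordered from left to right. -/
structure IsResidue (V : Fin m → Valuation) (R : List (Cell m)) : Prop where
  correct : ∀ c ∈ R, c.IsCorrect V
  sorted : R.Pairwise fun c c' => c.right ≤ c'.left

/-- The residue stays sorted, but the pieces `S j` join cells from several iterations and are only
disjoint. Disjointness is what additivity of values needs. -/
theorem IsResidue.isCells {V : Fin m → Valuation} {R : List (Cell m)} (h : IsResidue V R) :
    IsCells V R := by
  refine ⟨h.correct, ?_⟩
  refine h.sorted.imp_of_mem ?_
  intro c c' _ hc' hcc
  exact disjoint_intervalSet hcc (h.correct c' hc').lt (h.correct c' hc').le_one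

theorem IsCells.nil (V : Fin m → Valuation) : IsCells V [] := ⟨by simp, by simp⟩

theorem IsCells.append {V : Fin m → Valuation} {R R' : List (Cell m)} (h : IsCells V R)
    (h' : IsCells V R') (hd : Disjoint (cellsSet R) (cellsSet R')) : IsCells V (R ++ R') := by
  refine ⟨fun c hc => ?_, List.pairwise_append.2 ⟨h.disjoint, h'.disjoint, fun c hc c' hc' => ?_⟩⟩
  · rcases List.mem_append.1 hc with hc | hc
    exacts [h.correct c hc, h'.correct c hc]
  · exact hd.mono (fun x hx => mem_cellsSet.2 ⟨c, hc, hx⟩) (fun x hx => mem_cellsSet.2 ⟨c', hc', hx⟩)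

theorem IsCells.sublist {V : Fin m → Valuation} {R R' : List (Cell m)} (h : IsCells V R)
    (hs : R'.Sublist R) : IsCells V R' :=
  ⟨fun c hc => h.correct c (hs.subset hc), h.disjoint.sublist hs⟩

theorem IsResidue.sublist {V : Fin m → Valuation} {R R' : List (Cell m)} (h : IsResidue V R)
    (hs : R'.Sublist R) : IsResidue V R' :=
  ⟨fun c hc => h.correct c (hs.subset hc), h.sorted.sublist hs⟩

theorem IsResidue.tail {V : Fin m → Valuation} {c : Cell m} {R : List (Cell m)}
    (h : IsResidue V (c :: R)) : IsResidue V R := h.sublist (List.sublist_cons_self c R)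

theorem IsResidue.right_le_left {V : Fin m → Valuation} {c : Cell m} {R : List (Cell m)}
    (h : IsResidue V (c :: R)) : ∀ c' ∈ R, c.right ≤ c'.left := (List.pairwise_cons.1 h.sorted).1

theorem IsCells.wellFormed {V : Fin m → Valuation} {R : List (Cell m)} (h : IsCells V R) :
    (cellsPiece R).WellFormed := by
  refine ⟨?_, ?_⟩
  · intro I hI
    obtain ⟨c, hc, rfl⟩ := List.mem_map.1 hI
    exact ⟨(h.correct c hc).nonneg, (h.correct c hc).lt, (h.correct c hc).le_one⟩
  · exact List.pairwise_map.2 h.disjoint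

theorem IsCells.value_inter {V : Fin m → Valuation} {R : List (Cell m)} (h : IsCells V R)
    (i : Fin m) {A : Set ℝ} (hA : MeasurableSet A) :
    (V i).value (cellsSet R ∩ A) =
      (R.map fun c => (V i).value (Ioo c.left c.right ∩ A)).sum := by
  rw [cellsSet, value_toSet_inter _ h.wellFormed.2 hA, cellsPiece, List.map_map]
  refine congrArg List.sum (List.map_congr_left fun c _ => ?_)
  refine (V i).value_eq_of_Ioo (a := c.left) (b := c.right)
    (inter_subset_left.trans (intervalSet_subset_Icc (c.left, c.right)))
    (inter_subset_left.trans Ioo_subset_Icc_self) fun x hx => ?_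
  simp only [mem_inter_iff, hx, Ioo_subset_intervalSet (c.left, c.right) hx]

theorem IsCells.value {V : Fin m → Valuation} {R : List (Cell m)} (h : IsCells V R)
    (i : Fin m) : (V i).value (cellsSet R) = cellsValue i R := by
  have := h.value_inter i MeasurableSet.univ
  simp only [inter_univ] at this
  rw [this, cellsValue]
  refine congrArg List.sum (List.map_congr_left fun c hc => ?_)
  rw [(V i).value_Ioo (h.correct c hc).lt.le, (h.correct c hc).known]

theorem IsCells.cellsValue_nonneg {V : Fin m → Valuation} {R : List (Cell m)} (h : IsCells V R)
    (i : Fin m) : 0 ≤ cellsValue i R := by rw [← h.value]; exact (V i).value_nonneg _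

theorem IsCells.disjoint_filter {V : Fin m → Valuation} {R : List (Cell m)} (h : IsCells V R)
    {p q : Cell m → Bool} (hpq : ∀ c ∈ R, p c = true → q c = true → False) :
    Disjoint (cellsSet (R.filter p)) (cellsSet (R.filter q)) := by
  refine disjoint_left.2 fun x hx hx' => ?_
  obtain ⟨c, hc, hx⟩ := mem_cellsSet.1 hx
  obtain ⟨c', hc', hx'⟩ := mem_cellsSet.1 hx'
  rw [List.mem_filter] at hc hc'
  have hne : c ≠ c' := by
    rintro rfl; exact hpq c hc.1 hc.2 hc'.2
  have hs : Std.Symm fun c c' : Cell m =>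
    Disjoint (intervalSet (c.left, c.right)) (intervalSet (c'.left, c'.right)) :=
    ⟨fun _ _ h => h.symm⟩
  exact disjoint_left.1 (h.disjoint.forall hc.1 hc'.1 hne) hx hx'

@[simp] theorem cellsValue_nil (i : Fin m) : cellsValue i [] = 0 := rfl

@[simp] theorem cellsValue_cons (i : Fin m) (c : Cell m) (R : List (Cell m)) :
    cellsValue i (c :: R) = c.known i + cellsValue i R := by simp [cellsValue]

@[simp] theorem cellsValue_append (i : Fin m) (R R' : List (Cell m)) :
    cellsValue i (R ++ R') = cellsValue i R + cellsValue i R' := by simp [cellsValue]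

/-! ### The part of a residue to the left of a point -/

/-- The total increment of `F` over the part of `R` to the left of `x`. -/
def leftSum (F : ℝ → ℝ) (R : List (Cell m)) (x : ℝ) : ℝ :=
  (R.map fun c => F (max c.left (min x c.right)) - F c.left).sum

@[simp] theorem leftSum_cons (F : ℝ → ℝ) (c : Cell m) (R : List (Cell m)) (x : ℝ) :
    leftSum F (c :: R) x = F (max c.left (min x c.right)) - F c.left + leftSum F R x := by
  simp [leftSum]

theorem leftSum_mono {F : ℝ → ℝ} (hF : Monotone F) (R : List (Cell m)) :
    Monotone (leftSum F R) := by
  induction R with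
  | nil => exact monotone_const
  | cons c R ih =>
    intro x y h
    simp only [leftSum_cons]
    have : F (max c.left (min x c.right)) ≤ F (max c.left (min y c.right)) :=
      hF (max_le_max le_rfl (min_le_min h le_rfl))
    linarith [ih h]

theorem leftSum_continuous {F : ℝ → ℝ} (hF : Continuous F) (R : List (Cell m)) :
    Continuous (leftSum F R) := by
  induction R with
  | nil => exact continuous_const
  | cons c R ih =>
    have : leftSum F (c :: R) =
        fun x => F (max c.left (min x c.right)) - F c.left + leftSum F R x := by
      funext x; simp
    rw [this]
    fun_prop

theorem leftSum_eq_zero (F : ℝ → ℝ) {R : List (Cell m)} {x : ℝ} (h : ∀ c ∈ R, x ≤ c.left) :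
    leftSum F R x = 0 := by
  induction R with
  | nil => rfl
  | cons c R ih =>
    rw [leftSum_cons, ih fun c' hc' => h c' (by simp [hc']),
      max_eq_left ((min_le_left _ _).trans (h c (by simp)))]
    ring

theorem IsResidue.run_leftValue {V : Fin m → Valuation} {R : List (Cell m)} (h : IsResidue V R)
    (i : Fin m) (x : ℝ) : (leftValue i x R).run V = leftSum (V i).cdf R x := by
  induction R with
  | nil => rfl
  | cons c R ih =>
    have hc := h.correct c (by simp)
    rw [leftValue]
    split_ifs with h1 h2
    · rw [Protocol.run_done, leftSum_eq_zero]
      intro c' hc'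
      rcases List.mem_cons.1 hc' with rfl | hc'
      · exact h1
      · linarith [h.right_le_left c' hc', hc.lt]
    -- The point lies inside the first cell: one `Eval` query, and the sorted cells after it
    -- contribute nothing.
    · have h3 : (0 : ℝ) ≤ x := by linarith [hc.nonneg]
      rw [Protocol.run_eval, Protocol.run_done, Valuation.evalAnswer_eq, leftSum_cons,
        leftSum_eq_zero _ fun c' hc' => h2.le.trans (h.right_le_left c' hc'),
        Valuation.coe_clamp hc.nonneg (by linarith [hc.lt, hc.le_one]),
        Valuation.coe_clamp h3 (by linarith [hc.le_one]), min_eq_left h2.le,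
        max_eq_right (not_le.1 h1).le, add_zero,
        max_eq_right (sub_nonneg.2 ((V i).cdf_mono (not_le.1 h1).le))]
    · rw [Protocol.run_bind, Protocol.run_pure, ih h.tail, leftSum_cons, hc.known,
        min_eq_right (not_lt.1 h2), max_eq_right hc.lt.le]

theorem cost_leftValue_le (V : Fin m → Valuation) (i : Fin m) (x : ℝ) (R : List (Cell m)) :
    (leftValue i x R).cost V ≤ 1 := by
  induction R with
  | nil => simp [leftValue]
  | cons c R ih =>
    rw [leftValue]
    split_ifs
    · simp
    · simp
    · simpa using ih

theorem cost_mark_le (V : Fin m → Valuation) (i : Fin m) (w : ℝ) (R : List (Cell m)) :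
    (mark i w R).cost V ≤ 1 := by
  induction R generalizing w with
  | nil => simp [mark]
  | cons c R ih =>
    rw [mark]
    split_ifs
    · simp
    · exact ih _

theorem run_mark_mem (V : Fin m → Valuation) (i : Fin m) (w : ℝ) (R : List (Cell m)) :
    (mark i w R).run V ∈ Icc (0 : ℝ) 1 := by
  induction R generalizing w with
  | nil => simp [mark]
  | cons c R ih =>
    rw [mark]
    split_ifs
    · exact Subtype.prop _
    · exact ih _

theorem IsResidue.run_mark_of_lt {V : Fin m → Valuation} {R : List (Cell m)}
    (h : IsResidue V R) {i : Fin m} {w : ℝ} (hw : cellsValue i R < w) :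
    (mark i w R).run V = 1 := by
  induction R generalizing w with
  | nil => rfl
  | cons c R ih =>
    rw [cellsValue_cons] at hw
    have := h.tail.isCells.cellsValue_nonneg i
    rw [mark, if_neg (by linarith)]
    exact ih h.tail (by linarith)

/-- Recorded values locate the cell in which the running total reaches `w`, and one `Cut` inside it
finds the point. Minimality needs `0 < w`: for `w = 0` the mark is the left end of the first cell,
although points further left also have nothing of `R` before them. -/
theorem IsResidue.leftSum_run_mark {V : Fin m → Valuation} {R : List (Cell m)}
    (h : IsResidue V R) {i : Fin m} {w : ℝ} (hw0 : 0 ≤ w) (hw : w ≤ cellsValue i R) :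
    leftSum (V i).cdf R ((mark i w R).run V) = w ∧
      (0 < w → ∀ z, leftSum (V i).cdf R z = w → (mark i w R).run V ≤ z) := by
  induction R generalizing w with
  | nil =>
    have : w = 0 := le_antisymm hw hw0
    subst this
    exact ⟨rfl, fun h => absurd h (lt_irrefl _)⟩
  | cons c R ih =>
    have hc := h.correct c (by simp)
    have hcl : (clamp c.left : ℝ) = c.left :=
      Valuation.coe_clamp hc.nonneg (hc.lt.le.trans hc.le_one)
    have hF1 : (V i).cdf c.right ≤ 1 := by
      rw [← (V i).cdf_one]; exact (V i).cdf_mono hc.le_one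
    have hF0 : 0 ≤ (V i).cdf c.left := by
      rw [← (V i).cdf_zero]; exact (V i).cdf_mono hc.nonneg
    have hk := hc.known i
    rw [mark]
    split_ifs with h1
    · have hcw : (clamp w : ℝ) = w := Valuation.coe_clamp hw0 (by linarith)
      rw [Protocol.run_cut, Protocol.run_done]
      obtain ⟨a1, a2, a3⟩ := (V i).cutAnswer_spec (clamp c.left) (clamp w)
        (by rw [hcl, hcw]; linarith)
      rw [hcl, hcw] at a2 a3
      rw [← Subtype.coe_le_coe, hcl] at a1
      set y : ℝ := ((V i).cutAnswer (clamp c.left) (clamp w) : ℝ)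
      -- The cell is worth at least `w`, so the cut stays inside it.
      have hyr : y ≤ c.right := by
        obtain ⟨z, hz, hz'⟩ := intermediate_value_Icc hc.lt.le (V i).cdf_continuous.continuousOn
          (show (V i).cdf c.left + w ∈ Icc _ _ from ⟨by linarith, by linarith⟩)
        exact (a3 z hz.1 (hz.2.trans hc.le_one) hz').trans hz.2
      refine ⟨?_, fun hw z hz => ?_⟩
      · rw [leftSum_cons, leftSum_eq_zero _ fun c' hc' => hyr.trans (h.right_le_left c' hc'),
          min_eq_left hyr, max_eq_right a1, a2]
        ring
      · by_contra! hzy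
        have hzr : z ≤ c.right := hzy.le.trans hyr
        rw [leftSum_cons, leftSum_eq_zero _ fun c' hc' => hzr.trans (h.right_le_left c' hc'),
          min_eq_left hzr] at hz
        rcases le_or_gt c.left z with hl | hl
        · rw [max_eq_right hl] at hz
          exact absurd (a3 z hl (hzr.trans hc.le_one) (by linarith)) (not_le.2 hzy)
        · rw [max_eq_left hl.le] at hz
          linarith
    · rw [cellsValue_cons] at hw
      obtain ⟨b1, b2⟩ := ih h.tail (w := w - c.known i) (by linarith) (by linarith)
      set y := (mark i (w - c.known i) R).run V
      -- A positive value in the later cells forces the point beyond the first cell.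
      have key : ∀ z, leftSum (V i).cdf R z = w - c.known i → c.right ≤ z := by
        intro z hz
        by_contra! hlt
        rw [leftSum_eq_zero _ fun c' hc' => hlt.le.trans (h.right_le_left c' hc')] at hz
        linarith
      refine ⟨?_, fun _ z hz => ?_⟩
      · rw [leftSum_cons, b1, min_eq_right (key y b1), max_eq_right hc.lt.le]
        linarith
      · refine b2 (by linarith) z ?_
        rw [leftSum_cons] at hz
        rcases le_or_gt c.right z with hr | hr
        · rw [min_eq_right hr, max_eq_right hc.lt.le] at hz
          linarith
        · rw [leftSum_eq_zero _ fun c' hc' => hr.le.trans (h.right_le_left c' hc')] at hz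
          have := (V i).cdf_mono (show max c.left (min z c.right) ≤ c.right from
            max_le hc.lt.le (min_le_right _ _))
          linarith

/-! ### Cutting cells -/

/-- `R'` arises from `R` by cutting cells. -/
structure Refines (V : Fin m → Valuation) (R R' : List (Cell m)) : Prop where
  isResidue : IsResidue V R'
  cellsSet_eq : cellsSet R' = cellsSet R
  sub : ∀ c' ∈ R', ∃ c ∈ R, c.left ≤ c'.left ∧ c'.right ≤ c.right

theorem IsResidue.refines_refl {V : Fin m → Valuation} {R : List (Cell m)} (h : IsResidue V R) :
    Refines V R R := ⟨h, rfl, fun c hc => ⟨c, hc, le_rfl, le_rfl⟩⟩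

theorem Refines.trans {V : Fin m → Valuation} {R R' R'' : List (Cell m)} (h : Refines V R R')
    (h' : Refines V R' R'') : Refines V R R'' := by
  refine ⟨h'.isResidue, h'.cellsSet_eq.trans h.cellsSet_eq, fun c hc => ?_⟩
  obtain ⟨c', hc', h1, h2⟩ := h'.sub c hc
  obtain ⟨c'', hc'', h3, h4⟩ := h.sub c' hc'
  exact ⟨c'', hc'', h3.trans h1, h2.trans h4⟩

/-- Cells are ordered, so at most one has `x` in its interior. The value of its right part follows
by subtraction, which is why a cut needs only one query per agent. -/
theorem IsResidue.splitAt_spec {V : Fin m → Valuation} {R : List (Cell m)} (h : IsResidue V R)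
    (x : ℝ) : Refines V R ((splitAt x R).run V) ∧
      ∀ c ∈ (splitAt x R).run V, ¬ (c.left < x ∧ x < c.right) := by
  induction R with
  | nil => exact ⟨h.refines_refl, by simp [splitAt]⟩
  | cons c R ih =>
    have hc := h.correct c (by simp)
    rw [splitAt]
    split_ifs with hx
    · have hlx : 0 ≤ x := by linarith [hc.nonneg]
      have hx1 : x ≤ 1 := by linarith [hc.le_one]
      have hg : ∀ i, (Protocol.collect
          (fun i => Protocol.eval i (clamp c.left) (clamp x) Protocol.done)
          (List.finRange m)).run V i = (V i).cdf x - (V i).cdf c.left := by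
        intro i
        rw [Protocol.run_collect _ _ _ (List.mem_finRange i), Protocol.run_eval,
          Protocol.run_done, Valuation.evalAnswer_eq, Valuation.coe_clamp hlx hx1,
          Valuation.coe_clamp hc.nonneg (by linarith),
          max_eq_right (sub_nonneg.2 ((V i).cdf_mono hx.1.le))]
      simp only [Protocol.run_bind, Protocol.run_pure]
      refine ⟨⟨⟨?_, ?_⟩, ?_, ?_⟩, ?_⟩
      · intro c' hc'
        rcases List.mem_cons.1 hc' with rfl | hc'
        · exact ⟨hc.nonneg, hx.1, hx1, hg⟩
        rcases List.mem_cons.1 hc' with rfl | hc'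
        · refine ⟨hlx, hx.2, hc.le_one, fun i => ?_⟩
          simp only [hg, hc.known]
          ring
        · exact h.correct c' (by simp [hc'])
      · simp only [List.pairwise_cons, List.mem_cons]
        refine ⟨?_, fun c' hc' => h.right_le_left c' hc', h.tail.sorted⟩
        rintro c' (rfl | hc')
        · exact le_rfl
        · exact hx.2.le.trans (h.right_le_left c' hc')
      · simp only [cellsSet_cons]
        rw [intervalSet_eq_union hx.1 hx.2 hc.le_one, union_assoc]
      · intro c' hc'
        rcases List.mem_cons.1 hc' with rfl | hc'
        · exact ⟨c, by simp, le_rfl, hx.2.le⟩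
        rcases List.mem_cons.1 hc' with rfl | hc'
        · exact ⟨c, by simp, hx.1.le, le_rfl⟩
        · exact ⟨c', by simp [hc'], le_rfl, le_rfl⟩
      · intro c' hc'
        rcases List.mem_cons.1 hc' with rfl | hc'
        · exact fun h => lt_irrefl _ h.2
        rcases List.mem_cons.1 hc' with rfl | hc'
        · exact fun h => lt_irrefl _ h.1
        · have := h.right_le_left c' hc'
          exact fun h => by linarith [h.1, hx.2]
    · simp only [Protocol.run_bind, Protocol.run_pure]
      obtain ⟨h1, h2⟩ := ih h.tail
      refine ⟨⟨⟨?_, ?_⟩, ?_, ?_⟩, ?_⟩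
      · intro c' hc'
        rcases List.mem_cons.1 hc' with rfl | hc'
        · exact hc
        · exact h1.isResidue.correct c' hc'
      · refine List.pairwise_cons.2 ⟨fun c' hc' => ?_, h1.isResidue.sorted⟩
        obtain ⟨c'', hc'', h3, -⟩ := h1.sub c' hc'
        exact (h.right_le_left c'' hc'').trans h3
      · rw [cellsSet_cons, cellsSet_cons, h1.cellsSet_eq]
      · intro c' hc'
        rcases List.mem_cons.1 hc' with rfl | hc'
        · exact ⟨c', by simp, le_rfl, le_rfl⟩
        · obtain ⟨c'', hc'', h3, h4⟩ := h1.sub c' hc'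
          exact ⟨c'', by simp [hc''], h3, h4⟩
      · intro c' hc'
        rcases List.mem_cons.1 hc' with rfl | hc'
        · exact hx
        · exact h2 c' hc'

theorem cost_splitAt_le (V : Fin m → Valuation) (x : ℝ) (R : List (Cell m)) :
    (splitAt x R).cost V ≤ m := by
  induction R with
  | nil => simp [splitAt]
  | cons c R ih =>
    rw [splitAt]
    split_ifs
    · simp only [Protocol.cost_bind, Protocol.cost_pure, add_zero]
      refine (Protocol.cost_collect_le V _ _ (b := 1) fun j _ => by simp).trans ?_
      simp
    · simpa using ih

theorem length_splitAt_le (V : Fin m → Valuation) (x : ℝ) (R : List (Cell m)) :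
    ((splitAt x R).run V).length ≤ R.length + 1 := by
  induction R with
  | nil => simp [splitAt]
  | cons c R ih =>
    rw [splitAt]
    split_ifs
    · simp
    · simpa using ih

theorem IsResidue.splitAll_spec {V : Fin m → Valuation} {R : List (Cell m)} (h : IsResidue V R)
    (l : List ℝ) : Refines V R ((splitAll l R).run V) ∧
      ∀ x ∈ l, ∀ c ∈ (splitAll l R).run V, ¬ (c.left < x ∧ x < c.right) := by
  induction l generalizing R with
  | nil => exact ⟨h.refines_refl, by simp⟩
  | cons x l ih =>
    obtain ⟨h1, h2⟩ := h.splitAt_spec x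
    obtain ⟨h3, h4⟩ := ih h1.isResidue
    simp only [splitAll, Protocol.run_bind]
    refine ⟨h1.trans h3, fun y hy c hc => ?_⟩
    rcases List.mem_cons.1 hy with rfl | hy
    -- Later cuts only shrink cells, so they cannot undo this one.
    · obtain ⟨c', hc', h5, h6⟩ := h3.sub c hc
      exact fun h7 => h2 c' hc' ⟨by linarith [h7.1], by linarith [h7.2]⟩
    · exact h4 y hy c hc

theorem cost_splitAll_le (V : Fin m → Valuation) (l : List ℝ) (R : List (Cell m)) :
    (splitAll l R).cost V ≤ l.length * m := by
  induction l generalizing R with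
  | nil => simp [splitAll]
  | cons x l ih =>
    simp only [splitAll, Protocol.cost_bind, List.length_cons]
    have := cost_splitAt_le V x R
    have := ih ((splitAt x R).run V)
    nlinarith

theorem length_splitAll_le (V : Fin m → Valuation) (l : List ℝ) (R : List (Cell m)) :
    ((splitAll l R).run V).length ≤ R.length + l.length := by
  induction l generalizing R with
  | nil => simp [splitAll]
  | cons x l ih =>
    simp only [splitAll, Protocol.run_bind, List.length_cons]
    have := length_splitAt_le V x R
    have := ih ((splitAt x R).run V)
    omega

theorem Refines.cellsValue_eq {V : Fin m → Valuation} {R R' : List (Cell m)}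
    (h : Refines V R R') (hR : IsResidue V R) (i : Fin m) : cellsValue i R' = cellsValue i R := by
  rw [← h.isResidue.isCells.value, h.cellsSet_eq, hR.isCells.value]

/-- The cake as a residue. -/
def wholeCake (m : ℕ) : List (Cell m) := [⟨0, 1, fun _ => 1⟩]

theorem isResidue_wholeCake (V : Fin m → Valuation) : IsResidue V (wholeCake m) := by
  refine ⟨?_, by simp [wholeCake]⟩
  intro c hc
  obtain rfl := List.mem_singleton.1 hc
  exact ⟨le_rfl, zero_lt_one, le_rfl, fun i => by simp [Valuation.cdf_one, Valuation.cdf_zero]⟩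

theorem cellsSet_wholeCake : cellsSet (wholeCake m) = Icc 0 1 := by
  ext x
  simp only [wholeCake, cellsSet_cons, cellsSet_nil, union_empty, intervalSet, mem_ofPred_eq,
    mem_Icc, and_true, ← le_iff_lt_or_eq]

/-! ### The rescaled residue -/

section Coord

variable {m : ℕ} {V : Fin m → Valuation} {R : List (Cell m)}

/-- Strictness holds because the cell `c` has an interval of positive length between `x` and `z`.
With `F = id` it makes `coord` strictly increasing on cells, although it is constant on gaps. -/
theorem leftSum_lt {F : ℝ → ℝ} (hF : StrictMono F) {R : List (Cell m)} {c : Cell m} (hc : c ∈ R)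
    {x z : ℝ} (hxz : x < z) (hl : c.left < z) (hr : z ≤ c.right) :
    leftSum F R x < leftSum F R z := by
  induction R with
  | nil => simp at hc
  | cons c' R ih =>
    rw [leftSum_cons, leftSum_cons]
    rcases List.mem_cons.1 hc with rfl | hc
    · have h1 := leftSum_mono hF.monotone R hxz.le
      have h2 : F (max c.left (min x c.right)) < F (max c.left (min z c.right)) := by
        refine hF ?_
        rw [min_eq_left hr, min_eq_left (hxz.le.trans hr), max_eq_right hl.le]
        exact max_lt hl hxz
      linarith
    · have h1 := ih hc
      have h2 : F (max c'.left (min x c'.right)) ≤ F (max c'.left (min z c'.right)) :=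
        hF.monotone (max_le_max le_rfl (min_le_min hxz.le le_rfl))
      linarith

theorem IsResidue.length_eq (h : IsResidue V R) :
    (R.map fun c => c.right - c.left).sum = leftSum id R 1 := by
  refine congrArg List.sum (List.map_congr_left fun c hc => ?_)
  have := h.correct c hc
  rw [min_eq_right this.le_one, max_eq_right this.lt.le]
  rfl

theorem IsResidue.coord_eq (h : IsResidue V R) (x : ℝ) :
    coord R x = leftSum id R x / leftSum id R 1 := by
  rw [coord, h.length_eq]
  rfl

theorem IsResidue.leftSum_id_zero (h : IsResidue V R) : leftSum id R 0 = 0 :=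
  leftSum_eq_zero _ fun c hc => (h.correct c hc).nonneg

theorem IsResidue.leftSum_id_pos (h : IsResidue V R) (hR : R ≠ []) : 0 < leftSum id R 1 := by
  obtain ⟨c, hc⟩ := List.exists_mem_of_ne_nil R hR
  have hc' := h.correct c hc
  have h1 : leftSum id R 0 < leftSum id R c.right :=
    leftSum_lt strictMono_id hc (hc'.nonneg.trans_lt hc'.lt) hc'.lt le_rfl
  rw [h.leftSum_id_zero] at h1
  exact h1.trans_le (leftSum_mono monotone_id R hc'.le_one)

theorem IsResidue.coord_mono (h : IsResidue V R) (hR : R ≠ []) : Monotone (coord R) := by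
  intro x y hxy
  rw [h.coord_eq, h.coord_eq]
  exact div_le_div_of_nonneg_right (leftSum_mono monotone_id R hxy) (h.leftSum_id_pos hR).le

theorem IsResidue.coord_continuous (h : IsResidue V R) : Continuous (coord R) := by
  have : coord R = fun x => leftSum id R x / leftSum id R 1 := funext h.coord_eq
  rw [this]
  exact (leftSum_continuous continuous_id R).div_const _

theorem IsResidue.coord_zero (h : IsResidue V R) : coord R 0 = 0 := by
  rw [h.coord_eq, h.leftSum_id_zero, zero_div]

theorem IsResidue.coord_one (h : IsResidue V R) (hR : R ≠ []) : coord R 1 = 1 := by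
  rw [h.coord_eq, div_self (h.leftSum_id_pos hR).ne']

theorem IsResidue.coord_lt (h : IsResidue V R) {c : Cell m} (hc : c ∈ R)
    {x z : ℝ} (hxz : x < z) (hl : c.left < z) (hr : z ≤ c.right) : coord R x < coord R z := by
  rw [h.coord_eq, h.coord_eq]
  exact div_lt_div_of_pos_right (leftSum_lt strictMono_id hc hxz hl hr)
    (h.leftSum_id_pos (List.ne_nil_of_mem hc))

theorem IsResidue.coord_mem (h : IsResidue V R) (hR : R ≠ []) {x : ℝ} (hx : x ∈ Icc (0 : ℝ) 1) :
    coord R x ∈ Icc (0 : ℝ) 1 := by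
  constructor
  · rw [← h.coord_zero]; exact h.coord_mono hR hx.1
  · rw [← h.coord_one hR]; exact h.coord_mono hR hx.2

theorem IsResidue.isLeast_point (h : IsResidue V R) (hR : R ≠ []) {s : ℝ} (hs : s ≤ 1) :
    IsLeast {x : ℝ | 0 ≤ x ∧ x ≤ 1 ∧ s ≤ coord R x} (point R s) := by
  have hbd : BddBelow {x : ℝ | 0 ≤ x ∧ x ≤ 1 ∧ s ≤ coord R x} := ⟨0, fun x hx => hx.1⟩
  refine ⟨?_, fun x hx => csInf_le hbd hx⟩
  refine IsClosed.csInf_mem ?_ ⟨1, zero_le_one, le_rfl, by rwa [h.coord_one hR]⟩ hbd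
  have h1 : {x : ℝ | 0 ≤ x ∧ x ≤ 1 ∧ s ≤ coord R x} = Icc 0 1 ∩ coord R ⁻¹' Ici s := by
    ext x; simp [and_assoc]
  rw [h1]
  exact isClosed_Icc.inter (isClosed_Ici.preimage h.coord_continuous)

/-- `point` and `coord` form a Galois connection, so comparisons in the rescaled cake become
comparisons in the original one. -/
theorem IsResidue.le_coord_iff (h : IsResidue V R) (hR : R ≠ []) {s x : ℝ} (hs : s ≤ 1)
    (hx : x ∈ Icc (0 : ℝ) 1) : s ≤ coord R x ↔ point R s ≤ x := by
  have hp := h.isLeast_point hR hs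
  exact ⟨fun hsx => hp.2 ⟨hx.1, hx.2, hsx⟩, fun hsx => hp.1.2.2.trans (h.coord_mono hR hsx)⟩

theorem IsResidue.coord_point (h : IsResidue V R) (hR : R ≠ []) {s : ℝ}
    (hs : s ∈ Icc (0 : ℝ) 1) : coord R (point R s) = s := by
  have hp := h.isLeast_point hR hs.2
  refine le_antisymm ?_ hp.1.2.2
  obtain ⟨x, hx, hxs⟩ := intermediate_value_Icc zero_le_one h.coord_continuous.continuousOn
    (show s ∈ Icc _ _ by rw [h.coord_zero, h.coord_one hR]; exact hs)
  exact (h.coord_mono hR (hp.2 ⟨hx.1, hx.2, hxs.ge⟩)).trans hxs.le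

theorem IsResidue.coord_preimage_subsingleton (h : IsResidue V R) {c : Cell m} (hc : c ∈ R)
    (s : ℝ) : (Ioo c.left c.right ∩ coord R ⁻¹' {s}).Subsingleton := by
  rintro x ⟨hx, hxs⟩ y ⟨hy, hys⟩
  rw [mem_preimage, mem_singleton_iff] at hxs hys
  rcases lt_trichotomy x y with hxy | hxy | hxy
  · have := h.coord_lt hc hxy hy.1 hy.2.le
    linarith
  · exact hxy
  · have := h.coord_lt hc hxy hx.1 hx.2.le
    linarith

theorem IsResidue.ne_nil_of_pos {i : Fin m} (hi : 0 < cellsValue i R) : R ≠ [] := by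
  rintro rfl; simp at hi

/-- The valuation of agent `i` with respect to, and normalized on, the residue `R`. -/
noncomputable def IsResidue.valuation (h : IsResidue V R) (i : Fin m) (hi : 0 < cellsValue i R) :
    Valuation where
  measure := (ProbabilityTheory.cond (V i).measure (cellsSet R)).map (coord R)
  nonatomic := by
    refine ⟨fun s => ?_⟩
    rw [Measure.map_apply h.coord_continuous.measurable (measurableSet_singleton s),
      ProbabilityTheory.cond_apply (measurableSet_cellsSet R)]
    -- A fiber of `coord` meets the interior of each cell in at most one point, so the pushforward
    -- has no atoms.
    have h0 : (V i).value (cellsSet R ∩ coord R ⁻¹' {s}) = 0 := by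
      rw [h.isCells.value_inter i (h.coord_continuous.measurable (measurableSet_singleton s))]
      refine List.sum_eq_zero fun v hv => ?_
      obtain ⟨c, hc, rfl⟩ := List.mem_map.1 hv
      rw [Valuation.value, measureReal_def,
        (h.coord_preimage_subsingleton hc s).measure_zero, ENNReal.toReal_zero]
    rw [Valuation.value, measureReal_eq_zero_iff] at h0
    rw [h0, mul_zero]
  normalized := by
    have hne : (V i).measure (cellsSet R) ≠ 0 := by
      rw [← h.isCells.value] at hi
      intro h0
      rw [Valuation.value, measureReal_def, h0] at hi
      simp at hi
    have := ProbabilityTheory.cond_isProbabilityMeasure hne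
    rw [Measure.map_apply h.coord_continuous.measurable measurableSet_Icc, ← prob_compl_eq_zero_iff
      (h.coord_continuous.measurable measurableSet_Icc),
      ProbabilityTheory.cond_apply (measurableSet_cellsSet R)]
    have : cellsSet R ∩ (coord R ⁻¹' Icc 0 1)ᶜ = ∅ := by
      ext x
      simp only [mem_inter_iff, mem_compl_iff, mem_empty_iff_false, iff_false, not_and, not_not]
      intro hx
      obtain ⟨c, hc, hx⟩ := mem_cellsSet.1 hx
      have hx := intervalSet_subset_Icc _ hx
      exact h.coord_mem (List.ne_nil_of_mem hc) ⟨(h.correct c hc).nonneg.trans hx.1,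
        hx.2.trans (h.correct c hc).le_one⟩
    rw [this, measure_empty, mul_zero]
  supported := by
    rw [Measure.map_apply h.coord_continuous.measurable measurableSet_Icc.compl,
      ProbabilityTheory.cond_apply (measurableSet_cellsSet R)]
    have : cellsSet R ∩ (coord R ⁻¹' (Icc 0 1)ᶜ) = ∅ := by
      ext x
      simp only [mem_inter_iff, preimage_compl, mem_compl_iff, mem_empty_iff_false, iff_false,
        not_and, not_not]
      intro hx
      obtain ⟨c, hc, hx⟩ := mem_cellsSet.1 hx
      have hx := intervalSet_subset_Icc _ hx
      exact h.coord_mem (List.ne_nil_of_mem hc) ⟨(h.correct c hc).nonneg.trans hx.1,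
        hx.2.trans (h.correct c hc).le_one⟩
    rw [this, measure_empty, mul_zero]

theorem IsResidue.valuation_value (h : IsResidue V R) {i : Fin m} (hi : 0 < cellsValue i R)
    {A : Set ℝ} (hA : MeasurableSet A) :
    cellsValue i R * (h.valuation i hi).value A = (V i).value (cellsSet R ∩ coord R ⁻¹' A) := by
  have h1 : (h.valuation i hi).value A =
      (cellsValue i R)⁻¹ * (V i).value (cellsSet R ∩ coord R ⁻¹' A) := by
    rw [← h.isCells.value, Valuation.value, IsResidue.valuation,
      map_measureReal_apply h.coord_continuous.measurable hA, measureReal_def,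
      ProbabilityTheory.cond_apply (measurableSet_cellsSet R), ENNReal.toReal_mul,
      ENNReal.toReal_inv]
    rfl
  rw [h1, mul_inv_cancel_left₀ hi.ne']

/-- Inside a cell, `coord R z ≤ coord R x` means `z ≤ x`, because `coord` is strictly increasing
there. Recorded values and actual queries thus compute the rescaled distribution function. -/
theorem IsResidue.valuation_cdf (h : IsResidue V R) {i : Fin m} (hi : 0 < cellsValue i R)
    (x : ℝ) :
    cellsValue i R * (h.valuation i hi).cdf (coord R x) = leftSum (V i).cdf R x := by
  rw [Valuation.cdf, h.valuation_value hi measurableSet_Iic,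
    h.isCells.value_inter i (h.coord_continuous.measurable measurableSet_Iic), leftSum]
  refine congrArg List.sum (List.map_congr_left fun c hc => ?_)
  have hc' := h.correct c hc
  rw [← (V i).value_Ioc (le_max_left _ _)]
  refine (V i).value_eq_of_Ioo (a := c.left) (b := c.right)
    (inter_subset_left.trans Ioo_subset_Icc_self)
    (Ioc_subset_Icc_self.trans (Icc_subset_Icc_right (max_le hc'.lt.le (min_le_right _ _))))
    fun z hz => ?_
  simp only [mem_inter_iff, hz, true_and, mem_preimage, mem_Iic, mem_Ioc, hz.1]
  constructor
  · intro hzx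
    by_contra! hlt
    have : x < z := by
      by_contra! hle
      exact absurd hlt (not_lt.2 ((le_min hle hz.2.le).trans (le_max_right _ _)))
    exact absurd hzx (not_le.2 (h.coord_lt hc this hz.1 hz.2.le))
  · intro hzx
    rcases le_max_iff.1 hzx with h1 | h1
    · exact absurd hz.1 (not_lt.2 h1)
    · exact h.coord_mono (List.ne_nil_of_mem hc) (h1.trans (min_le_left _ _))

/-- Every simulated answer equals the answer of the rescaled valuation, so both runs follow the same
branch of the decision tree. An `Eval` needs two left values, a `Cut` one left value and one mark,
hence the factor `2`. -/
theorem IsResidue.run_simulate {α : Type} (h : IsResidue V R) (hR : ∀ i, 0 < cellsValue i R)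
    (p : Protocol (Fin m) α) :
    (simulate R p).run V = p.run (fun i => h.valuation i (hR i)) ∧
      (simulate R p).cost V ≤ 2 * p.cost (fun i => h.valuation i (hR i)) := by
  have hpt : ∀ (i : Fin m) (s : unitInterval),
      (leftValue i (point R s) R).run V = cellsValue i R * (h.valuation i (hR i)).cdf s := by
    intro i s
    rw [h.run_leftValue, ← h.valuation_cdf (hR i),
      h.coord_point (IsResidue.ne_nil_of_pos (hR i)) s.2]
  induction p with
  | done a => exact ⟨rfl, Nat.zero_le _⟩
  | eval i s t k ih =>
    simp only [simulate, Protocol.run_bind, Protocol.cost_bind, hpt, Protocol.run_eval,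
      Protocol.cost_eval]
    -- The maximum with `0` covers reversed end points, for which `Eval` returns the value of the
    -- empty set.
    have : max 0 ((cellsValue i R * (h.valuation i (hR i)).cdf t -
        cellsValue i R * (h.valuation i (hR i)).cdf s) / cellsValue i R) =
        (h.valuation i (hR i)).evalAnswer s t := by
      rw [Valuation.evalAnswer_eq, ← mul_sub, mul_div_cancel_left₀ _ (hR i).ne']
    rw [this]
    obtain ⟨h1, h2⟩ := ih ((h.valuation i (hR i)).evalAnswer s t)
    refine ⟨h1, ?_⟩
    have := cost_leftValue_le V i (point R s) R
    have := cost_leftValue_le V i (point R t) R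
    omega
  | cut i s v k ih =>
    have hne := IsResidue.ne_nil_of_pos (hR i)
    set W := h.valuation i (hR i) with hW
    -- A mark finds the leftmost point with a given value before it. For `v = 0` this may lie left
    -- of `s`, whereas the `Cut` answer is `s` itself.
    by_cases hv : v = 0
    · have hans : W.cutAnswer s v = s := by
        refine W.cutAnswer_eq le_rfl (by simp [hv]) fun z hz _ _ => hz
      rw [simulate, if_pos hv, Protocol.run_cut, Protocol.cost_cut, ← hW, hans]
      exact ⟨(ih s).1, (ih s).2.trans (by omega)⟩
    · have hv0 : (0 : ℝ) < v := unitInterval.pos_iff_ne_zero.2 hv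
      simp only [simulate, if_neg hv, Protocol.run_bind, Protocol.cost_bind, hpt,
        Protocol.run_cut, Protocol.cost_cut, ← hW]
      have hans : clamp (coord R ((mark i (cellsValue i R * W.cdf s + v * cellsValue i R) R).run V))
          = W.cutAnswer s v := by
        have hw : cellsValue i R * W.cdf s + v * cellsValue i R =
            cellsValue i R * (W.cdf s + v) := by ring
        rw [hw]
        set x := (mark i (cellsValue i R * (W.cdf s + v)) R).run V with hx
        have hxm : coord R x ∈ Icc (0 : ℝ) 1 := h.coord_mem hne (run_mark_mem V i _ R)
        have hs0 : 0 ≤ W.cdf s := W.value_nonneg _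
        -- If too little cake remains, the mark is `1`, which agrees with the default answer of
        -- `Cut`.
        rcases le_or_gt (W.cdf s + v) 1 with h1 | h1
        · obtain ⟨e1, e2⟩ := h.leftSum_run_mark (i := i) (w := cellsValue i R * (W.cdf s + v))
            (mul_nonneg (hR i).le (by linarith)) (mul_le_of_le_one_right (hR i).le h1)
          rw [← hx, ← h.valuation_cdf (hR i)] at e1
          have e3 : W.cdf (coord R x) = W.cdf s + v := mul_left_cancel₀ (hR i).ne' e1
          refine (W.cutAnswer_eq ?_ ?_ ?_).symm
          · rw [← Subtype.coe_le_coe, Valuation.coe_clamp hxm.1 hxm.2]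
            by_contra! hlt
            have := W.cdf_mono hlt.le
            linarith
          · rw [Valuation.coe_clamp hxm.1 hxm.2, e3]
          · intro z hz hz1 hzv
            have hz' : z ∈ Icc (0 : ℝ) 1 := ⟨s.2.1.trans hz, hz1⟩
            rw [Valuation.coe_clamp hxm.1 hxm.2, ← h.coord_point hne hz']
            refine h.coord_mono hne (e2 (mul_pos (hR i) (by linarith)) _ ?_)
            rw [← h.valuation_cdf (hR i), h.coord_point hne hz', ← hW, hzv]
        · have : x = 1 := h.run_mark_of_lt (by
            calc cellsValue i R = cellsValue i R * 1 := (mul_one _).symm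
              _ < _ := mul_lt_mul_of_pos_left h1 (hR i))
          rw [this, h.coord_one hne, W.cutAnswer_eq_one s v h1]
          exact Valuation.clamp_coe 1
      rw [hans]
      obtain ⟨h1, h2⟩ := ih (W.cutAnswer s v)
      refine ⟨h1, ?_⟩
      have := cost_leftValue_le V i (point R s) R
      have := cost_mark_le V i (cellsValue i R * W.cdf s + v * cellsValue i R) R
      omega

/-! ### The cells of a piece of the rescaled residue -/

open Classical in
-- No cell of `R'` has the preimage of an end point of `B` in its interior, so the interior lies
-- entirely inside or entirely outside the piece, and the midpoint decides which.
theorem Refines.value_cellsOf {R' : List (Cell m)} (hR : Refines V R R') (h : IsResidue V R)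
    {i : Fin m} (hi : 0 < cellsValue i R) {B : Fin m → Piece}
    (hB : ∀ j, (B j).WellFormed)
    (hcut : ∀ x ∈ (endpoints B).map (point R), ∀ c ∈ R', ¬ (c.left < x ∧ x < c.right))
    (j : Fin m) :
    cellsValue i (cellsOf R R' B j) =
      cellsValue i R * (h.valuation i hi).value (B j).toSet := by
  have hne := IsResidue.ne_nil_of_pos hi
  have hmeas := h.coord_continuous.measurable (measurableSet_toSet (B j))
  rw [h.valuation_value hi (measurableSet_toSet (B j)), ← hR.cellsSet_eq,
    hR.isResidue.isCells.value_inter i hmeas]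
  have key : ∀ c ∈ R', ∀ x ∈ Ioo c.left c.right,
      (coord R x ∈ (B j).toSet ↔ coord R ((c.left + c.right) / 2) ∈ (B j).toSet) := by
    intro c hc x hx
    have hc' := hR.isResidue.correct c hc
    have h1 : ∀ y ∈ Ioo c.left c.right, y ∈ Icc (0 : ℝ) 1 := fun y hy =>
      ⟨hc'.nonneg.trans hy.1.le, hy.2.le.trans hc'.le_one⟩
    have hmid : (c.left + c.right) / 2 ∈ Ioo c.left c.right := by
      constructor <;> linarith [hc'.lt]
    have hle : ∀ e ∈ endpoints B, e ≤ 1 →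
        (e ≤ coord R x ↔ e ≤ coord R ((c.left + c.right) / 2)) := by
      intro e he he1
      have hout := hcut _ (List.mem_map_of_mem he) c hc
      rw [h.le_coord_iff hne he1 (h1 x hx), h.le_coord_iff hne he1 (h1 _ hmid)]
      constructor
      · intro hp
        by_contra! hlt
        exact hout ⟨hmid.1.trans hlt, hp.trans_lt hx.2⟩
      · intro hp
        by_contra! hlt
        exact hout ⟨hx.1.trans hlt, hp.trans_lt hmid.2⟩
    have hI : ∀ I ∈ B j, (coord R x ∈ intervalSet I ↔
        coord R ((c.left + c.right) / 2) ∈ intervalSet I) := by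
      intro I hI
      have hend : I.1 ∈ endpoints B ∧ I.2 ∈ endpoints B := by
        simp only [endpoints, List.mem_flatMap]
        exact ⟨⟨j, List.mem_finRange j, I, hI, by simp⟩, ⟨j, List.mem_finRange j, I, hI, by simp⟩⟩
      obtain ⟨-, hI2, hI3⟩ := (hB j).1 I hI
      have e1 := hle _ hend.1 (hI2.le.trans hI3)
      have e2 := hle _ hend.2 hI3
      have e3 := (h.coord_mem hne (h1 x hx)).2
      have e4 := (h.coord_mem hne (h1 _ hmid)).2
      simp only [intervalSet, mem_ofPred_eq, e1, ← not_le, e2]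
      -- An interval ending at `1` is closed there; since coordinates are at most `1`, being equal
      -- to `1` is again a comparison with an end point.
      refine and_congr_right fun _ => or_congr_right (and_congr_left fun hI1 => ?_)
      rw [hI1] at e2
      exact ⟨fun hx1 => le_antisymm e4 (e2.1 hx1.ge), fun hx1 => le_antisymm e3 (e2.2 hx1.ge)⟩
    constructor
    · rintro ⟨I, hIB, hxI⟩; exact ⟨I, hIB, (hI I hIB).1 hxI⟩
    · rintro ⟨I, hIB, hxI⟩; exact ⟨I, hIB, (hI I hIB).2 hxI⟩
  have hterm : ∀ c ∈ R', (V i).value (Ioo c.left c.right ∩ coord R ⁻¹' (B j).toSet) =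
      if coord R ((c.left + c.right) / 2) ∈ (B j).toSet then c.known i else 0 := by
    intro c hc
    have hc' := hR.isResidue.correct c hc
    split_ifs with hmem
    · rw [hc'.known, ← (V i).value_Ioo hc'.lt.le]
      congr 1
      exact inter_eq_left.2 fun x hx => (key c hc x hx).2 hmem
    · have : Ioo c.left c.right ∩ coord R ⁻¹' (B j).toSet = ∅ :=
        eq_empty_of_forall_notMem fun x hx => hmem ((key c hc x hx.1).1 hx.2)
      rw [this, Valuation.value_empty]
  rw [List.map_congr_left hterm, cellsValue, cellsOf]
  clear hterm key hcut hR
  induction R' with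
  | nil => rfl
  | cons c R' ih =>
    rw [List.filter_cons]
    split_ifs with hmem
    · rw [decide_eq_true_eq] at hmem
      rw [List.map_cons, List.sum_cons, ih, List.map_cons, List.sum_cons, if_pos hmem]
    · rw [decide_eq_true_eq] at hmem
      rw [ih, List.map_cons, List.sum_cons, if_neg hmem, zero_add]

theorem Refines.disjoint_cellsOf {R' : List (Cell m)} (hR : Refines V R R') {B : Fin m → Piece}
    (hB : IsAllocation B) {j k : Fin m} (hjk : j ≠ k) :
    Disjoint (cellsSet (cellsOf R R' B j)) (cellsSet (cellsOf R R' B k)) := by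
  refine hR.isResidue.isCells.disjoint_filter fun c _ h1 h2 => ?_
  simp only [decide_eq_true_eq] at h1 h2
  exact disjoint_left.1 (hB.2 j k hjk) h1 h2

theorem Refines.iUnion_cellsOf {R' : List (Cell m)} (hR : Refines V R R') (h : IsResidue V R)
    {B : Fin m → Piece} (hB : IsComplete B) :
    ⋃ j, cellsSet (cellsOf R R' B j) = cellsSet R := by
  rw [← hR.cellsSet_eq]
  refine Subset.antisymm (iUnion_subset fun j => cellsSet_mono (List.filter_subset_self _)) ?_
  intro x hx
  obtain ⟨c, hc, hxc⟩ := mem_cellsSet.1 hx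
  have hc' := hR.isResidue.correct c hc
  obtain ⟨c₀, hc₀, -⟩ := hR.sub c hc
  have hmid : coord R ((c.left + c.right) / 2) ∈ Icc (0 : ℝ) 1 :=
    h.coord_mem (List.ne_nil_of_mem hc₀)
      ⟨by linarith [hc'.nonneg, hc'.lt], by linarith [hc'.le_one, hc'.lt]⟩
  rw [← hB] at hmid
  obtain ⟨j, hj⟩ := mem_iUnion.1 hmid
  exact mem_iUnion.2 ⟨j, mem_cellsSet.2 ⟨c, List.mem_filter.2 ⟨hc, by simpa using hj⟩, hxc⟩⟩

theorem length_endpoints (B : Fin m → Piece) :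
    (endpoints B).length = 2 * ∑ j, (B j).length := by
  rw [endpoints, List.length_flatMap, Finset.mul_sum, ← List.sum_ofFn, List.ofFn_eq_map]
  congr 1
  refine List.map_congr_left fun j _ => ?_
  rw [List.length_flatMap]
  simp [mul_comm]

end Coord

/-! ### The first phase -/

section PhaseOne

variable {n : ℕ} {V : Fin (n + 1) → Valuation}

/-- The cells of `S 0, …, S (n-1)` and of the residue `R` form a partition of the cake. -/
structure IsPartialAllocation (V : Fin (n + 1) → Valuation) (S : Fin n → List (Cell (n + 1)))
    (R : List (Cell (n + 1))) : Prop where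
  isResidue : IsResidue V R
  isCells : ∀ j, IsCells V (S j)
  disjoint : ∀ j k, j ≠ k → Disjoint (cellsSet (S j)) (cellsSet (S k))
  disjoint_residue : ∀ j, Disjoint (cellsSet (S j)) (cellsSet R)
  union_eq : (⋃ j, cellsSet (S j)) ∪ cellsSet R = Icc 0 1

theorem isPartialAllocation_wholeCake :
    IsPartialAllocation V (fun _ => []) (wholeCake (n + 1)) :=
  ⟨isResidue_wholeCake V, fun _ => IsCells.nil V, by simp, by simp, by
    simp [cellsSet_wholeCake]⟩

theorem IsPartialAllocation.sum_cellsValue {S : Fin n → List (Cell (n + 1))}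
    {R : List (Cell (n + 1))} (h : IsPartialAllocation V S R) (i : Fin (n + 1)) :
    ∑ j, cellsValue i (S j) + cellsValue i R = 1 := by
  have h1 := (V i).value_unit
  rw [← h.union_eq, (V i).value_union _ (measurableSet_cellsSet R), h.isResidue.isCells.value,
    Valuation.value, measureReal_iUnion_fintype (fun j k hjk => h.disjoint j k hjk)
      (fun j => measurableSet_cellsSet _)] at h1
  · rw [← h1]
    congr 1
    exact Finset.sum_congr rfl fun j _ => ((h.isCells j).value i).symm
  · exact disjoint_iUnion_left.2 h.disjoint_residue

/-- One iteration of the first phase. -/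
theorem IsPartialAllocation.step {S : Fin n → List (Cell (n + 1))}
    {R R' : List (Cell (n + 1))} (h : IsPartialAllocation V S R) (hR' : Refines V R R')
    {B : Fin (n + 1) → Piece} (hB : IsAllocation B) (hB' : IsComplete B) :
    IsPartialAllocation V (fun j => S j ++ cellsOf R R' B j.castSucc)
      (cellsOf R R' B (Fin.last n)) := by
  have hsub : ∀ j, cellsSet (cellsOf R R' B j) ⊆ cellsSet R := fun j => by
    rw [← hR'.iUnion_cellsOf h.isResidue hB']
    exact subset_iUnion (fun j => cellsSet (cellsOf R R' B j)) j
  refine ⟨hR'.isResidue.sublist List.filter_sublist, fun j => ?_, fun j k hjk => ?_, fun j => ?_,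
    ?_⟩
  · exact (h.isCells j).append (hR'.isResidue.isCells.sublist List.filter_sublist)
      ((h.disjoint_residue j).mono_right (hsub _))
  · simp only [cellsSet_append, disjoint_union_left, disjoint_union_right]
    refine ⟨⟨h.disjoint j k hjk, ?_⟩, ?_, ?_⟩
    · exact (h.disjoint_residue k).symm.mono_left (hsub _)
    · exact (h.disjoint_residue j).mono_right (hsub _)
    · exact hR'.disjoint_cellsOf hB fun he => hjk (Fin.castSucc_injective n he)
  · simp only [cellsSet_append, disjoint_union_left]
    exact ⟨(h.disjoint_residue j).mono_right (hsub _),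
      hR'.disjoint_cellsOf hB (Fin.castSucc_lt_last j).ne⟩
  · rw [← h.union_eq, ← hR'.iUnion_cellsOf h.isResidue hB']
    ext x
    simp only [cellsSet_append, mem_union, mem_iUnion, Fin.exists_fin_succ', exists_or]
    tauto

/-- The bound on differences is a potential argument: the error of each iteration is charged to the
value that the residue loses in it. The hypothesis `hδ1` keeps the residue valuable to everybody, so
that the next iteration can be normalized on it. -/
theorem IsPartialAllocation.run_phaseOne {P : Protocol (Fin (n + 1)) (Fin (n + 1) → Piece)}
    {κ δ : ℝ} (hP : IsPerfectSubroutine κ δ P) (hδ : 0 < δ)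
    (hδ1 : δ < 1 / ((n + 1 : ℕ) : ℝ)) (hδ2 : 1 / ((n + 1 : ℕ) : ℝ) + δ ≤ 1 / 2) (d : ℕ)
    {S : Fin n → List (Cell (n + 1))} {R : List (Cell (n + 1))}
    (h : IsPartialAllocation V S R) (hR : ∀ i, 0 < cellsValue i R) :
    IsPartialAllocation V ((phaseOne P d S R).run V).1 ((phaseOne P d S R).run V).2 ∧
    (∀ i, (1 / ((n + 1 : ℕ) : ℝ) - δ) ^ d * cellsValue i R ≤
        cellsValue i ((phaseOne P d S R).run V).2 ∧
      cellsValue i ((phaseOne P d S R).run V).2 ≤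
        (1 / ((n + 1 : ℕ) : ℝ) + δ) ^ d * cellsValue i R) ∧
    (∀ i j k, cellsValue i (((phaseOne P d S R).run V).1 j) -
        cellsValue i (((phaseOne P d S R).run V).1 k) ≤
      cellsValue i (S j) - cellsValue i (S k) +
        4 * δ * (cellsValue i R - cellsValue i ((phaseOne P d S R).run V).2)) ∧
    ((phaseOne P d S R).cost V : ℝ) ≤ d * (4 * (κ * (((n + 1 : ℕ) : ℝ) ^ 3 / δ))) := by
  induction d generalizing S R with
  | zero => exact ⟨h, fun i => by simp [phaseOne], fun i j k => by simp [phaseOne],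
      by simp [phaseOne]⟩
  | succ d ih =>
    set q : ℝ := 1 / ((n + 1 : ℕ) : ℝ) with hq
    simp only [phaseOne, Protocol.run_bind, Protocol.cost_bind]
    obtain ⟨hrun, hcost⟩ := h.isResidue.run_simulate hR P
    obtain ⟨hB, hB', hperf, hc, hlen⟩ := hP (fun i => h.isResidue.valuation i (hR i))
    rw [hrun]
    set W := fun i => h.isResidue.valuation i (hR i) with hW
    set B := P.run W with hBdef
    obtain ⟨hR', hcut⟩ := h.isResidue.splitAll_spec ((endpoints B).map (point R))
    have hsplit := cost_splitAll_le V ((endpoints B).map (point R)) R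
    set R' := (splitAll ((endpoints B).map (point R)) R).run V with hR'def
    have hval : ∀ i j, (q - δ) * cellsValue i R ≤ cellsValue i (cellsOf R R' B j) ∧
        cellsValue i (cellsOf R R' B j) ≤ (q + δ) * cellsValue i R := by
      intro i j
      rw [hR'.value_cellsOf h.isResidue (hR i) hB.1 hcut j, mul_comm _ (cellsValue i R),
        mul_comm _ (cellsValue i R)]
      exact ⟨mul_le_mul_of_nonneg_left (hperf i j).1 (hR i).le,
        mul_le_mul_of_nonneg_left (hperf i j).2 (hR i).le⟩
    have hpos : ∀ i, 0 < cellsValue i (cellsOf R R' B (Fin.last n)) := fun i =>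
      (mul_pos (sub_pos.2 hδ1) (hR i)).trans_le (hval i _).1
    obtain ⟨g1, g2, g3, g4⟩ := ih (h.step hR' hB hB') hpos
    refine ⟨g1, fun i => ⟨?_, ?_⟩, fun i j k => ?_, ?_⟩
    · refine le_trans ?_ (g2 i).1
      rw [pow_succ, mul_assoc]
      exact mul_le_mul_of_nonneg_left (hval i _).1 (pow_nonneg (sub_nonneg.2 hδ1.le) d)
    · refine (g2 i).2.trans ?_
      rw [pow_succ, mul_assoc]
      exact mul_le_mul_of_nonneg_left (hval i _).2 (pow_nonneg (by positivity) d)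
    · refine (g3 i j k).trans ?_
      rw [cellsValue_append, cellsValue_append]
      have e1 := (hval i j.castSucc).2
      have e2 := (hval i k.castSucc).1
      have e3 := (hval i (Fin.last n)).2
      -- The residue loses at least half its value, so the new error `2δ` times the old residue is
      -- at most `4δ` times the loss.
      have e4 : cellsValue i (cellsOf R R' B (Fin.last n)) ≤ 1 / 2 * cellsValue i R :=
        e3.trans (mul_le_mul_of_nonneg_right hδ2 (hR i).le)
      have e5 := mul_le_mul_of_nonneg_left e4 hδ.le
      linarith
    · rw [List.length_map, length_endpoints] at hsplit
      have f1 : ((simulate R P).cost V : ℝ) ≤ 2 * (κ * (((n + 1 : ℕ) : ℝ) ^ 3 / δ)) := by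
        have : ((simulate R P).cost V : ℝ) ≤ 2 * (P.cost W : ℝ) := by exact_mod_cast hcost
        linarith
      -- Each interval of `B` has two end points, and each cut costs up to `n + 1` queries. This
      -- turns the interval bound of the subroutine into the same order as its query bound.
      have f2 : ((splitAll ((endpoints B).map (point R)) R).cost V : ℝ) ≤
          2 * (κ * (((n + 1 : ℕ) : ℝ) ^ 3 / δ)) := by
        have f3 : ((splitAll ((endpoints B).map (point R)) R).cost V : ℝ) ≤
            2 * ((∑ j, (B j).length : ℕ) : ℝ) * ((n + 1 : ℕ) : ℝ) := by exact_mod_cast hsplit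
        have f4 := mul_le_mul_of_nonneg_right hlen (Nat.cast_nonneg (α := ℝ) (n + 1))
        have f5 : κ * (((n + 1 : ℕ) : ℝ) ^ 2 / δ) * ((n + 1 : ℕ) : ℝ) =
            κ * (((n + 1 : ℕ) : ℝ) ^ 3 / δ) := by ring
        linarith
      push_cast at f1 f2 g4 ⊢
      linarith

end PhaseOne

/-! ### The second phase -/

theorem IsResidue.leftSum_eq_value {m : ℕ} {V : Fin m → Valuation} {R : List (Cell m)}
    (h : IsResidue V R) (i : Fin m) (x : ℝ) :
    leftSum (V i).cdf R x = (V i).value (cellsSet R ∩ Iic x) := by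
  rw [h.isCells.value_inter i measurableSet_Iic, leftSum]
  refine congrArg List.sum (List.map_congr_left fun c hc => ?_)
  have hc' := h.correct c hc
  rw [← (V i).value_Ioc (le_max_left _ _)]
  refine (V i).value_eq_of_Ioo (a := c.left) (b := c.right)
    (Ioc_subset_Icc_self.trans (Icc_subset_Icc_right (max_le hc'.lt.le (min_le_right _ _))))
    (inter_subset_left.trans Ioo_subset_Icc_self) fun z hz => ?_
  simp [hz, hz.1, hz.1.not_ge, hz.2.le]

theorem IsResidue.cellsValue_left {m : ℕ} {V : Fin m → Valuation} {R : List (Cell m)}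
    (h : IsResidue V R) {x : ℝ} (hx : ∀ c ∈ R, ¬ (c.left < x ∧ x < c.right)) (i : Fin m) :
    cellsValue i (R.filter fun c => decide (c.right ≤ x)) = leftSum (V i).cdf R x := by
  induction R with
  | nil => rfl
  | cons c R ih =>
    have hc := h.correct c (by simp)
    have hxc := hx c (by simp)
    rw [leftSum_cons, ← ih h.tail fun c' hc' => hx c' (by simp [hc']), List.filter_cons]
    split_ifs with hr
    · rw [decide_eq_true_eq] at hr
      rw [cellsValue_cons, hc.known, min_eq_right hr, max_eq_right hc.lt.le]
    · rw [decide_eq_true_eq, not_le] at hr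
      have hl : x ≤ c.left := by
        by_contra! hl; exact hxc ⟨hl, hr⟩
      rw [min_eq_left hr.le, max_eq_left hl, sub_self, zero_add]

theorem cellsSet_filter_union {m : ℕ} (R : List (Cell m)) (p : Cell m → Prop) [DecidablePred p] :
    cellsSet (R.filter fun c => decide (p c)) ∪ cellsSet (R.filter fun c => decide (¬ p c)) =
      cellsSet R := by
  ext x
  simp only [mem_union, mem_cellsSet, List.mem_filter, decide_eq_true_eq, ← exists_or, ← or_and_right,
    ← and_or_left, Classical.em, and_true]

theorem finRange_filter_singleton {n : ℕ} (j : Fin n) :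
    (List.finRange n).filter (fun k => decide (k ∈ ({j} : Finset (Fin n)))) = [j] := by
  simp only [Finset.mem_singleton]
  have : ((List.finRange n).filter fun k => decide (k = j)) =
      List.replicate ((List.finRange n).count j) j := by
    rw [← List.filter_eq]
  rw [this, List.count_eq_one_of_mem (List.nodup_finRange n) (List.mem_finRange j),
    List.replicate_one]

section PhaseTwo

variable {n : ℕ} {V : Fin (n + 1) → Valuation} {sel : (Fin n → ℝ) → Finset (Fin n) → Fin n}
  {S : Fin n → List (Cell (n + 1))}

theorem IsSelector.favorite_mem (hsel : IsSelector sel) {T : Finset (Fin n)} (hT : T.Nonempty)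
    (i : Fin n) : favorite sel S T i ∈ T := (hsel _ T hT).1

theorem IsSelector.le_favorite (hsel : IsSelector sel) {T : Finset (Fin n)} {j : Fin n}
    (hj : j ∈ T) (i : Fin n) :
    cellsValue i.castSucc (S j) ≤ cellsValue i.castSucc (S (favorite sel S T i)) :=
  neg_le_neg_iff.1 ((hsel (fun j => -cellsValue i.castSucc (S j)) T ⟨j, hj⟩).2 j hj)

/-- A round makes at most `n` marks and one cut, which records `n + 1` values. -/
theorem cost_phaseTwo_le (V : Fin (n + 1) → Valuation)
    (sel : (Fin n → ℝ) → Finset (Fin n) → Fin n) (S : Fin n → List (Cell (n + 1))) (k : ℕ)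
    (M T : Finset (Fin n)) (R : List (Cell (n + 1))) :
    (phaseTwo sel S k M T R).cost V ≤ k * (2 * n + 1) := by
  induction k generalizing M T R with
  | zero => simp [phaseTwo]
  | succ k ih =>
    simp only [phaseTwo, Protocol.cost_bind, Protocol.cost_pure, add_zero]
    have h1 := Protocol.cost_collect_le V
      (fun i : Fin n =>
        mark i.castSucc (1 / (n : ℝ) - cellsValue i.castSucc (S (favorite sel S T i))) R)
      ((List.finRange n).filter (fun i => i ∈ M)) (b := 1) (fun _ _ => cost_mark_le V _ _ R)
    have h2 := List.length_filter_le (fun i => decide (i ∈ M)) (List.finRange n)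
    rw [List.length_finRange] at h2
    refine (Nat.add_le_add h1 (Nat.add_le_add (cost_splitAt_le V _ _) (ih _ _ _))).trans ?_
    have h3 : (k + 1) * (2 * n + 1) = n + (n + 1 + k * (2 * n + 1)) := by ring
    omega

/-- The pieces handed out in the second phase. -/
theorem IsSelector.run_phaseTwo (hsel : IsSelector sel) (hS : ∀ j, IsCells V (S j))
    (hSS : ∀ j k, j ≠ k → Disjoint (cellsSet (S j)) (cellsSet (S k))) (k : ℕ)
    {M T : Finset (Fin n)} (hM : M.card = k + 1) (hT : T.card = k + 1)
    {R : List (Cell (n + 1))} (hR : IsResidue V R)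
    (hSR : ∀ j, Disjoint (cellsSet (S j)) (cellsSet R)) :
    (∀ i, i ∉ M → (phaseTwo sel S k M T R).run V i = []) ∧
    IsAllocation ((phaseTwo sel S k M T R).run V) ∧
    (⋃ i, Piece.toSet ((phaseTwo sel S k M T R).run V i)) =
      cellsSet R ∪ ⋃ j ∈ T, cellsSet (S j) ∧
    (∀ i ∈ M, ∃ j ∈ T, cellsSet (S j) ⊆ Piece.toSet ((phaseTwo sel S k M T R).run V i) ∧
      Piece.toSet ((phaseTwo sel S k M T R).run V i) ⊆ cellsSet (S j) ∪ cellsSet R) ∧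
    ((∀ i ∈ M, (∀ j ∈ T, cellsValue i.castSucc (S j) ≤ 1 / (n : ℝ)) ∧
        ((k : ℝ) + 1) * (1 / (n : ℝ)) ≤
          cellsValue i.castSucc R + ∑ j ∈ T, cellsValue i.castSucc (S j)) →
      ∀ i ∈ M, 1 / (n : ℝ) ≤
        (V i.castSucc).value (Piece.toSet ((phaseTwo sel S k M T R).run V i))) := by
  induction k generalizing M T R with
  | zero =>
    obtain ⟨i₀, rfl⟩ := Finset.card_eq_one.1 hM
    obtain ⟨j₀, rfl⟩ := Finset.card_eq_one.1 hT
    have hA : (phaseTwo sel S 0 {i₀} {j₀} R).run V =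
        fun i => if i = i₀ then cellsPiece (R ++ S j₀) else [] := by
      rw [phaseTwo, Protocol.run_done, finRange_filter_singleton]
      funext i
      simp
    have hcells : IsCells V (R ++ S j₀) := hR.isCells.append (hS j₀) (hSR j₀).symm
    have hset : ∀ i, Piece.toSet (if i = i₀ then cellsPiece (R ++ S j₀) else []) =
        if i = i₀ then cellsSet R ∪ cellsSet (S j₀) else ∅ := by
      intro i
      split_ifs
      · exact cellsSet_append R (S j₀)
      · exact toSet_nil
    rw [hA]
    simp only [hset, IsAllocation, Finset.mem_singleton, forall_eq, exists_eq_left, if_true,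
      iUnion_iUnion_eq_left]
    refine ⟨fun i hi => if_neg hi, ⟨fun i => ?_, fun i i' hii => ?_⟩, ?_, ⟨subset_union_right, by rw [union_comm]⟩,
      fun h => ?_⟩
    · split_ifs
      · exact hcells.wellFormed
      · exact ⟨by simp, by simp⟩
    · by_cases h1 : i = i₀
      · rw [if_neg (c := i' = i₀) fun h2 => hii (h1.trans h2.symm)]; exact disjoint_empty _
      · rw [if_neg h1]; exact empty_disjoint _
    · ext x
      simp only [mem_iUnion]
      constructor
      · rintro ⟨i, hi⟩
        split_ifs at hi
        · exact hi
        · exact hi.elim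
      · intro hx
        exact ⟨i₀, by rwa [if_pos rfl]⟩
    -- For the last agent the invariant with `k = 0` says that the remainder is worth at least
    -- `1/n`.
    · rw [← cellsSet_append, hcells.value, cellsValue_append]
      have := h.2
      rw [Finset.sum_singleton] at this
      simpa using this
  | succ k ih =>
    have hMne : M.Nonempty := Finset.card_pos.1 (by omega)
    have hTne : T.Nonempty := Finset.card_pos.1 (by omega)
    simp only [phaseTwo, Protocol.run_bind, Protocol.run_pure]
    set marks := (Protocol.collect
        (fun i : Fin n =>
          mark i.castSucc (1 / (n : ℝ) - cellsValue i.castSucc (S (favorite sel S T i))) R)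
        ((List.finRange n).filter (fun i => i ∈ M))).run V with hmarks
    have hmark : ∀ i ∈ M, marks i = (mark i.castSucc
        (1 / (n : ℝ) - cellsValue i.castSucc (S (favorite sel S T i))) R).run V := fun i hi =>
      Protocol.run_collect V _ _ (by simp [hi])
    obtain ⟨hi₀, hmin⟩ := hsel marks M hMne
    set i₀ := sel marks M with hi₀def
    have hj₀ : favorite sel S T i₀ ∈ T := hsel.favorite_mem hTne i₀
    set j₀ := favorite sel S T i₀ with hj₀def
    obtain ⟨hR', hcut⟩ := hR.splitAt_spec (marks i₀)
    set R' := (splitAt (marks i₀) R).run V with hR'def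
    set L := R'.filter (fun c => decide (c.right ≤ marks i₀)) with hL
    set R'' := R'.filter (fun c => decide (¬ c.right ≤ marks i₀)) with hR''
    have hunion : cellsSet L ∪ cellsSet R'' = cellsSet R :=
      (cellsSet_filter_union R' _).trans hR'.cellsSet_eq
    have hLR : cellsSet L ⊆ cellsSet R := hunion ▸ subset_union_left
    have hRR : cellsSet R'' ⊆ cellsSet R := hunion ▸ subset_union_right
    have hdisj : Disjoint (cellsSet L) (cellsSet R'') :=
      hR'.isResidue.isCells.disjoint_filter fun c _ h1 h2 => by
        simp only [decide_eq_true_eq] at h1 h2; exact h2 h1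
    have hLcells : IsCells V (L ++ S j₀) :=
      (hR'.isResidue.isCells.sublist List.filter_sublist).append (hS j₀)
        ((hSR j₀).symm.mono_left hLR)
    obtain ⟨g0, g1, g2, g3, g4⟩ := ih (M := M.erase i₀) (T := T.erase j₀)
      (by rw [Finset.card_erase_of_mem hi₀, hM]; rfl)
      (by rw [Finset.card_erase_of_mem hj₀, hT]; rfl)
      (hR'.isResidue.sublist List.filter_sublist) (fun j => (hSR j).mono_right hRR)
    set A := (phaseTwo sel S k (M.erase i₀) (T.erase j₀) R'').run V with hA
    have hset₀ : Piece.toSet (cellsPiece (L ++ S j₀)) = cellsSet L ∪ cellsSet (S j₀) :=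
      cellsSet_append L (S j₀)
    have hAi : ∀ i, Disjoint (cellsSet L ∪ cellsSet (S j₀)) (Piece.toSet (A i)) := by
      intro i
      refine Disjoint.mono_right ((subset_iUnion (fun i => Piece.toSet (A i)) i).trans g2.le) ?_
      refine disjoint_union_right.2 ⟨disjoint_union_left.2 ⟨hdisj, (hSR j₀).mono_right hRR⟩,
        disjoint_iUnion₂_right.2 fun j hj => disjoint_union_left.2
          ⟨(hSR j).symm.mono_left hLR, hSS _ _ (Finset.ne_of_mem_erase hj).symm⟩⟩
    have hup : ∀ i, Piece.toSet (Function.update A i₀ (cellsPiece (L ++ S j₀)) i) =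
        if i = i₀ then cellsSet L ∪ cellsSet (S j₀) else Piece.toSet (A i) := by
      intro i
      split_ifs with h
      · rw [h, Function.update_self, hset₀]
      · rw [Function.update_of_ne h]
    refine ⟨fun i hi => ?_, ⟨fun i => ?_, fun i i' hii => ?_⟩, ?_, fun i hi => ?_, fun hprop i hi => ?_⟩
    · rw [Function.update_of_ne fun h : i = i₀ => hi (h ▸ hi₀)]
      exact g0 i fun h => hi (Finset.mem_of_mem_erase h)
    · by_cases h : i = i₀
      · rw [h, Function.update_self]; exact hLcells.wellFormed
      · rw [Function.update_of_ne h]; exact g1.1 i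
    · rw [hup, hup]
      by_cases h : i = i₀
      · have h' : i' ≠ i₀ := fun h' => hii (h.trans h'.symm)
        rw [if_pos h, if_neg h']
        exact hAi i'
      · by_cases h' : i' = i₀
        · rw [if_neg h, if_pos h']; exact (hAi i).symm
        · rw [if_neg h, if_neg h']; exact g1.2 i i' hii
    · have h1 : (⋃ i, Piece.toSet (Function.update A i₀ (cellsPiece (L ++ S j₀)) i)) =
          (cellsSet L ∪ cellsSet (S j₀)) ∪ ⋃ i, Piece.toSet (A i) := by
        refine Subset.antisymm (iUnion_subset fun i => ?_)
          (union_subset ?_ (iUnion_subset fun i => ?_))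
        · rw [hup]
          split_ifs
          · exact subset_union_left
          · exact (subset_iUnion (fun i => Piece.toSet (A i)) i).trans subset_union_right
        · refine Subset.trans ?_ (subset_iUnion _ i₀)
          rw [hup, if_pos rfl]
        · by_cases h : i = i₀
          · rw [h, g0 i₀ (Finset.notMem_erase i₀ M), toSet_nil]
            exact empty_subset _
          · refine Subset.trans ?_ (subset_iUnion _ i)
            rw [hup, if_neg h]
      have h2 : (⋃ j ∈ T, cellsSet (S j)) =
          cellsSet (S j₀) ∪ ⋃ j ∈ T.erase j₀, cellsSet (S j) := by
        conv_lhs => rw [← Finset.insert_erase hj₀]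
        rw [Finset.set_biUnion_insert]
      rw [h1, g2, h2, ← hunion]
      ext x
      simp only [mem_union]
      tauto
    · rw [hup]
      by_cases h : i = i₀
      · rw [if_pos h]
        exact ⟨j₀, hj₀, subset_union_right, union_comm (cellsSet L) _ ▸
          union_subset_union_right _ hLR⟩
      · rw [if_neg h]
        obtain ⟨j, hj, h1, h2⟩ := g3 i (Finset.mem_erase.2 ⟨h, hi⟩)
        exact ⟨j, Finset.mem_of_mem_erase hj, h1, h2.trans (union_subset_union_right _ hRR)⟩
    · have hleft : ∀ i, cellsValue i L = leftSum (V i).cdf R (marks i₀) := fun i => by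
        rw [hL, hR'.isResidue.cellsValue_left hcut, hR'.isResidue.leftSum_eq_value,
          hR'.cellsSet_eq, hR.leftSum_eq_value]
      have hright : ∀ i, cellsValue i L + cellsValue i R'' = cellsValue i R := fun i => by
        rw [← (hR'.isResidue.isCells.sublist List.filter_sublist).value,
          ← (hR'.isResidue.isCells.sublist List.filter_sublist).value,
          ← (V i).value_union hdisj (measurableSet_cellsSet _), hunion, hR.isCells.value]
      -- The mark exists: all `k + 2` available pieces are at most the favorite, so the residue is
      -- worth at least `k + 2` times the nonnegative deficit of the favorite, hence at least the
      -- deficit.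
      have hmarkval : ∀ i ∈ M, leftSum (V i.castSucc).cdf R (marks i) =
          1 / (n : ℝ) - cellsValue i.castSucc (S (favorite sel S T i)) := by
        intro i hi
        obtain ⟨p1, p2⟩ := hprop i hi
        have q1 := p1 _ (hsel.favorite_mem (S := S) hTne i)
        have q2 : ∑ j ∈ T, cellsValue i.castSucc (S j) ≤
            T.card • cellsValue i.castSucc (S (favorite sel S T i)) :=
          Finset.sum_le_card_nsmul _ _ _ fun j hj => hsel.le_favorite hj i
        rw [hT, nsmul_eq_mul] at q2
        rw [hmark i hi]
        refine (hR.leftSum_run_mark (sub_nonneg.2 q1) ?_).1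
        push_cast at q2 p2
        nlinarith [mul_nonneg (add_nonneg (Nat.cast_nonneg (α := ℝ) k) zero_le_one)
          (sub_nonneg.2 q1)]
      rw [hup]
      by_cases h : i = i₀
      · rw [if_pos h, ← hset₀]
        change _ ≤ (V i.castSucc).value (cellsSet (L ++ S j₀))
        rw [hLcells.value, cellsValue_append, hleft, h, hmarkval i₀ hi₀]
        linarith
      · rw [if_neg h]
        refine g4 (fun i hi => ?_) i (Finset.mem_erase.2 ⟨h, hi⟩)
        obtain ⟨-, hi⟩ := Finset.mem_erase.1 hi
        obtain ⟨p1, p2⟩ := hprop i hi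
        refine ⟨fun j hj => p1 j (Finset.mem_of_mem_erase hj), ?_⟩
        -- The part removed ends at the leftmost mark, so it is worth at most the deficit of agent
        -- `i`. Together with a piece no better than her favorite she sees at most `1/n` leave.
        have e1 : cellsValue i.castSucc L ≤ _ :=
          (hleft i.castSucc).le.trans (leftSum_mono (V i.castSucc).cdf_mono R (hmin i hi))
        rw [hmarkval i hi] at e1
        have e2 := hsel.le_favorite (S := S) hj₀ i
        have e3 := hright i.castSucc
        have e4 := Finset.add_sum_erase T (fun j => cellsValue i.castSucc (S j)) hj₀
        push_cast at p2
        linarith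

end PhaseTwo

/-! ### Balanced colorings -/

/-- Fewer homogeneous linear equations than variables have a nontrivial solution. -/
theorem exists_ne_zero_of_card_lt {α κ : Type*} {F : Finset α} {K : Finset κ}
    (h : K.card < F.card) (a : κ → α → ℝ) :
    ∃ d : α → ℝ, (∃ p ∈ F, d p ≠ 0) ∧ (∀ p, p ∉ F → d p = 0) ∧
      ∀ k ∈ K, ∑ p ∈ F, a k p * d p = 0 := by
  classical
  let f : (F → ℝ) →ₗ[ℝ] (K → ℝ) := (Matrix.of fun (k : K) (p : F) => a k p).mulVecLin
  have hf : LinearMap.ker f ≠ ⊥ := by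
    apply LinearMap.ker_ne_bot_of_finrank_lt
    simpa using h
  obtain ⟨e, he, hne⟩ := (Submodule.ne_bot_iff _).1 hf
  obtain ⟨⟨p, hp⟩, hpe⟩ := Function.ne_iff.1 hne
  refine ⟨fun p => if hp : p ∈ F then e ⟨p, hp⟩ else 0, ⟨p, hp, by simpa [hp] using hpe⟩,
    fun p hp => dif_neg hp, fun k hk => ?_⟩
  have := congrFun (LinearMap.mem_ker.1 he) ⟨k, hk⟩
  simp only [f, Matrix.mulVecLin_apply, Matrix.mulVec, dotProduct, Matrix.of_apply,
    Pi.zero_apply] at this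
  rw [← this, ← Finset.sum_coe_sort F]
  exact Finset.sum_congr rfl fun p _ => by simp

/-- From a point in an open cube one can move in a given direction to the boundary. -/
theorem exists_step_to_boundary {α : Type*} {F : Finset α} {x d : α → ℝ}
    (hx : ∀ p ∈ F, 0 < x p ∧ x p < 1) (hd : ∃ p ∈ F, d p ≠ 0) :
    ∃ t : ℝ, (∀ p ∈ F, 0 ≤ x p + t * d p ∧ x p + t * d p ≤ 1) ∧
      ∃ p ∈ F, x p + t * d p = 0 ∨ x p + t * d p = 1 := by
  classical
  -- The time at which a moving coordinate leaves `[0,1]`; the first of these times is the step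
  -- length.
  let τ : α → ℝ := fun p => if 0 < d p then (1 - x p) / d p else x p / (-d p)
  obtain ⟨p₀, hp₀, hd₀⟩ := hd
  obtain ⟨p, hp, hmin⟩ := (F.filter fun p => d p ≠ 0).exists_min_image τ
    ⟨p₀, Finset.mem_filter.2 ⟨hp₀, hd₀⟩⟩
  rw [Finset.mem_filter] at hp
  have hτ : ∀ q ∈ F, d q ≠ 0 → 0 < τ q := by
    intro q hq hdq
    simp only [τ]
    split_ifs with h
    · exact div_pos (sub_pos.2 (hx q hq).2) h
    · exact div_pos (hx q hq).1 (neg_pos.2 (lt_of_le_of_ne (not_lt.1 h) hdq))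
  have hpos := hτ p hp.1 hp.2
  refine ⟨τ p, fun q hq => ?_, p, hp.1, ?_⟩
  · have hxq := hx q hq
    rcases lt_trichotomy (d q) 0 with h | h | h
    · have h1 := hmin q (Finset.mem_filter.2 ⟨hq, h.ne⟩)
      have h2 : τ q * (-d q) = x q := by
        simp only [τ, if_neg h.not_gt]
        exact div_mul_cancel₀ _ (neg_pos.2 h).ne'
      have h3 := mul_le_mul_of_nonneg_right h1 (neg_pos.2 h).le
      have h4 := mul_pos hpos (neg_pos.2 h)
      constructor <;> linarith
    · rw [h, mul_zero, add_zero]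
      exact ⟨hxq.1.le, hxq.2.le⟩
    · have h1 := hmin q (Finset.mem_filter.2 ⟨hq, h.ne'⟩)
      have h2 : τ q * d q = 1 - x q := by
        simp only [τ, if_pos h]
        exact div_mul_cancel₀ _ h.ne'
      have h3 := mul_le_mul_of_nonneg_right h1 h.le
      have h4 := mul_pos hpos h
      constructor <;> linarith
  · by_cases h : 0 < d p
    · right
      have h2 : τ p * d p = 1 - x p := by
        simp only [τ, if_pos h]
        exact div_mul_cancel₀ _ h.ne'
      linarith
    · left
      have h' := lt_of_le_of_ne (not_lt.1 h) hp.2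
      have h2 : τ p * (-d p) = x p := by
        simp only [τ, if_neg h]
        exact div_mul_cancel₀ _ (neg_pos.2 h').ne'
      linarith

section Rounding

variable {C : Type*} {m : ℕ}

/-- The entries of a fractional assignment that are strictly between `0` and `1`. -/
noncomputable def fractionalEntries (s : Finset C) (x : C × Fin m → ℝ) : Finset (C × Fin m) :=
  (s ×ˢ Finset.univ).filter fun p => 0 < x p ∧ x p < 1

theorem mem_fractionalEntries {s : Finset C} {x : C × Fin m → ℝ} {p : C × Fin m} :
    p ∈ fractionalEntries s x ↔ p.1 ∈ s ∧ 0 < x p ∧ x p < 1 := by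
  simp [fractionalEntries]

variable [DecidableEq C]

/-- A row of entries in `[0,1]` with sum `1` cannot have exactly one fractional entry: another entry
`1` makes the sum too large, and zeros elsewhere make it too small. -/
theorem two_mul_card_image_le {s : Finset C} {x : C × Fin m → ℝ}
    (hx : ∀ p : C × Fin m, p.1 ∈ s → 0 ≤ x p ∧ x p ≤ 1) (hsum : ∀ c ∈ s, ∑ j, x (c, j) = 1) :
    2 * ((fractionalEntries s x).image Prod.fst).card ≤ (fractionalEntries s x).card := by
  refine Finset.mul_card_image_le_card _ 2 fun c hc => ?_
  obtain ⟨⟨c', j⟩, hp, rfl⟩ := Finset.mem_image.1 hc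
  obtain ⟨hcs, h0, h1⟩ := mem_fractionalEntries.1 hp
  simp only at hcs
  obtain ⟨k, hkj, hk0, hk1⟩ : ∃ k, k ≠ j ∧ 0 < x (c', k) ∧ x (c', k) < 1 := by
    by_contra! hcon
    have hs := hsum c' hcs
    rw [← Finset.add_sum_erase _ _ (Finset.mem_univ j)] at hs
    by_cases hone : ∃ k, k ≠ j ∧ x (c', k) = 1
    · obtain ⟨k, hkj, hk⟩ := hone
      have := Finset.single_le_sum (f := fun k => x (c', k)) (s := Finset.univ.erase j)
        (fun l _ => (hx (c', l) hcs).1) (Finset.mem_erase.2 ⟨hkj, Finset.mem_univ k⟩)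
      linarith
    · push Not at hone
      rw [Finset.sum_eq_zero fun k hk => ?_] at hs
      · linarith
      · have hkj := Finset.ne_of_mem_erase hk
        by_contra hne
        have h2 := hcon k hkj (lt_of_le_of_ne (hx (c', k) hcs).1 (Ne.symm hne))
        exact hone k hkj (le_antisymm (hx (c', k) hcs).2 h2)
  refine Finset.one_lt_card.2 ⟨(c', j), ?_, (c', k), ?_, fun h => hkj (congrArg Prod.snd h).symm⟩
  · exact Finset.mem_filter.2 ⟨hp, rfl⟩
  · exact Finset.mem_filter.2 ⟨mem_fractionalEntries.2 ⟨hcs, hk0, hk1⟩, rfl⟩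

/-- Beck–Fiala rounding. Row sums, and those (agent, color) sums whose fractional entries still
carry load above `2Δ`, are kept exact; they number fewer than the fractional entries, so one can
move until another entry becomes integral. A sum that is no longer protected can change by at most
its remaining load, which is at most `2Δ`. -/
theorem exists_rounding {s : Finset C} {v : C → Fin m → ℝ} {Δ : ℝ}
    (hv : ∀ c ∈ s, ∀ i, 0 ≤ v c i) (hΔ : ∀ c ∈ s, ∑ i, v c i ≤ Δ) (hΔ0 : 0 ≤ Δ)
    {x : C × Fin m → ℝ} (hx : ∀ p : C × Fin m, p.1 ∈ s → 0 ≤ x p ∧ x p ≤ 1)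
    (hsum : ∀ c ∈ s, ∑ j, x (c, j) = 1) :
    ∃ y : C × Fin m → ℝ, (∀ p : C × Fin m, p.1 ∈ s → y p = 0 ∨ y p = 1) ∧
      (∀ c ∈ s, ∑ j, y (c, j) = 1) ∧ (∀ p, p ∉ fractionalEntries s x → y p = x p) ∧
      ∀ i j, |∑ c ∈ s, v c i * (y (c, j) - x (c, j))| ≤ 2 * Δ := by
  induction hN : (fractionalEntries s x).card using Nat.strong_induction_on generalizing x with
  | _ N ih =>
  set F := fractionalEntries s x with hF
  rcases F.eq_empty_or_nonempty with hemp | hne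
  · refine ⟨x, fun p hp => ?_, hsum, fun _ _ => rfl, fun i j => by simpa using hΔ0⟩
    by_contra! hcon
    have : p ∈ F := mem_fractionalEntries.2
      ⟨hp, lt_of_le_of_ne (hx p hp).1 (Ne.symm hcon.1), lt_of_le_of_ne (hx p hp).2 hcon.2⟩
    rw [hemp] at this
    simp at this
  let load : Fin m × Fin m → ℝ := fun a => ∑ p ∈ F with p.2 = a.2, v p.1 a.1
  let A : Finset (Fin m × Fin m) := Finset.univ.filter fun a => 2 * Δ < load a
  have hFs : ∀ p ∈ F, p.1 ∈ s := fun p hp => (mem_fractionalEntries.1 hp).1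
  -- Double counting: all loads together are at most `|F|Δ`, and each protected one exceeds `2Δ`.
  -- With the bound of at most `|F|/2` fractional rows, strictness here leaves a free direction.
  have hA : 2 * A.card < F.card := by
    rcases A.eq_empty_or_nonempty with hA | hA
    · rw [hA]; simpa using hne
    have h1 : A.card • (2 * Δ) < ∑ a ∈ A, load a := by
      rw [← Finset.sum_const]
      exact Finset.sum_lt_sum_of_nonempty hA fun a ha => (Finset.mem_filter.1 ha).2
    have h2 : ∑ a ∈ A, load a ≤ ∑ a, load a :=
      Finset.sum_le_sum_of_subset_of_nonneg (Finset.subset_univ _) fun a _ _ =>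
        Finset.sum_nonneg fun p hp => hv _ (hFs p (Finset.mem_filter.1 hp).1) _
    have h3 : ∑ a, load a = ∑ p ∈ F, ∑ i, v p.1 i := by
      rw [Fintype.sum_prod_type, Finset.sum_comm (s := F)]
      refine Finset.sum_congr rfl fun i _ => ?_
      exact Finset.sum_fiberwise F Prod.snd fun p => v p.1 i
    have h4 : ∑ p ∈ F, ∑ i, v p.1 i ≤ F.card • Δ :=
      Finset.sum_le_card_nsmul _ _ _ fun p hp => hΔ _ (hFs p hp)
    rw [nsmul_eq_mul] at h1 h4
    have h5 : (2 * A.card : ℝ) * Δ < F.card * Δ := by linarith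
    exact_mod_cast lt_of_mul_lt_mul_right h5 hΔ0
  have hC := two_mul_card_image_le hx hsum
  rw [← hF] at hC
  let K : Finset (C ⊕ (Fin m × Fin m)) := (F.image Prod.fst).disjSum A
  have hK : K.card < F.card := by
    rw [Finset.card_disjSum]; omega
  obtain ⟨d, hd, hd0, hdK⟩ := exists_ne_zero_of_card_lt hK
    (Sum.elim (fun c p => if p.1 = c then 1 else 0)
      (fun a p => if p.2 = a.2 then v p.1 a.1 else 0))
  have hcol : ∀ g : C × Fin m → ℝ, (∀ p, p ∉ F → g p = 0) → ∀ j,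
      ∑ c ∈ s, g (c, j) = ∑ p ∈ F with p.2 = j, g p := by
    intro g hg j
    have h1 : ∑ c ∈ s, g (c, j) = ∑ p ∈ s ×ˢ {j}, g p := by
      rw [Finset.sum_product]; simp
    rw [h1]
    symm
    refine Finset.sum_subset (fun p hp => ?_) fun p hp hp' => ?_
    · rw [Finset.mem_filter] at hp
      exact Finset.mem_product.2 ⟨hFs p hp.1, Finset.mem_singleton.2 hp.2⟩
    · refine hg p fun hpF => hp' (Finset.mem_filter.2 ⟨hpF, ?_⟩)
      simpa using (Finset.mem_product.1 hp).2
  have hdrow : ∀ c ∈ s, ∑ j, d (c, j) = 0 := by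
    intro c _
    by_cases hcF : c ∈ F.image Prod.fst
    · have h1 := hdK (Sum.inl c) (Finset.inl_mem_disjSum.2 hcF)
      simp only [Sum.elim_inl, ite_mul, one_mul, zero_mul] at h1
      rw [← Finset.sum_filter] at h1
      rw [← h1]
      have h2 : ∑ j, d (c, j) = ∑ p ∈ ({c} : Finset C) ×ˢ Finset.univ, d p := by
        rw [Finset.sum_product]; simp
      rw [h2]
      symm
      refine Finset.sum_subset (fun p hp => ?_) fun p hp hp' => ?_
      · rw [Finset.mem_filter] at hp
        exact Finset.mem_product.2 ⟨Finset.mem_singleton.2 hp.2, Finset.mem_univ _⟩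
      · refine hd0 p fun hpF => hp' (Finset.mem_filter.2 ⟨hpF, ?_⟩)
        simpa using (Finset.mem_product.1 hp).1
    · refine Finset.sum_eq_zero fun j _ => hd0 _ fun h => hcF ?_
      exact Finset.mem_image.2 ⟨(c, j), h, rfl⟩
  have hdA : ∀ a ∈ A, ∑ c ∈ s, v c a.1 * d (c, a.2) = 0 := by
    intro a ha
    have h1 := hdK (Sum.inr a) (Finset.inr_mem_disjSum.2 ha)
    simp only [Sum.elim_inr, ite_mul, zero_mul] at h1
    rw [← Finset.sum_filter] at h1
    rw [← h1]
    exact hcol (fun p => v p.1 a.1 * d p) (fun p hp => by rw [hd0 p hp, mul_zero]) a.2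
  obtain ⟨t, ht, p₁, hp₁, ht₁⟩ := exists_step_to_boundary
    (fun p hp => (mem_fractionalEntries.1 hp).2) hd
  set x' : C × Fin m → ℝ := fun p => x p + t * d p with hx'
  have hx'F : ∀ p, p ∉ F → x' p = x p := fun p hp => by simp [hx', hd0 p hp]
  have hsub : fractionalEntries s x' ⊂ F := by
    refine (Finset.ssubset_iff_of_subset fun p hp => ?_).2 ⟨p₁, hp₁, fun h => ?_⟩
    · by_contra hpF
      obtain ⟨h1, h2⟩ := mem_fractionalEntries.1 hp
      rw [hx'F p hpF] at h2
      exact hpF (mem_fractionalEntries.2 ⟨h1, h2⟩)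
    · have h2 := (mem_fractionalEntries.1 h).2
      rcases ht₁ with h1 | h1 <;> simp only [hx', h1] at h2 <;> linarith [h2.1, h2.2]
  obtain ⟨y, y1, y2, y3, y4⟩ := ih _ (hN ▸ Finset.card_lt_card hsub) (x := x')
    (fun p hp => by
      by_cases hpF : p ∈ F
      · exact ht p hpF
      · rw [hx'F p hpF]; exact hx p hp)
    (fun c hc => by
      simp only [hx', Finset.sum_add_distrib, ← Finset.mul_sum, hdrow c hc, hsum c hc]
      ring) rfl
  have hyx : ∀ p, p ∉ F → y p = x p := fun p hp => by
    rw [y3 p fun h => hp (hsub.1 h), hx'F p hp]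
  refine ⟨y, y1, y2, hyx, fun i j => ?_⟩
  by_cases ha : (i, j) ∈ A
  · have h1 : ∑ c ∈ s, v c i * (y (c, j) - x (c, j)) =
        ∑ c ∈ s, v c i * (y (c, j) - x' (c, j)) + t * ∑ c ∈ s, v c i * d (c, j) := by
      rw [Finset.mul_sum, ← Finset.sum_add_distrib]
      refine Finset.sum_congr rfl fun c _ => ?_
      simp only [hx']
      ring
    rw [h1, hdA (i, j) ha, mul_zero, add_zero]
    exact y4 i j
  · have h1 : load (i, j) ≤ 2 * Δ := by
      by_contra! h
      exact ha (Finset.mem_filter.2 ⟨Finset.mem_univ _, h⟩)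
    refine le_trans ?_ h1
    -- Only entries that are fractional now can still change, each by at most `1`.
    rw [hcol (fun p => v p.1 i * (y p - x p)) (fun p hp => by rw [hyx p hp, sub_self, mul_zero]) j]
    refine (Finset.abs_sum_le_sum_abs _ _).trans (Finset.sum_le_sum fun p hp => ?_)
    have hpF := (Finset.mem_filter.1 hp).1
    rw [abs_mul, abs_of_nonneg (hv _ (hFs p hpF) i)]
    refine mul_le_of_le_one_right (hv _ (hFs p hpF) i) ?_
    have := (mem_fractionalEntries.1 hpF).2
    rw [abs_le]
    rcases y1 p (hFs p hpF) with h | h <;> rw [h] <;> constructor <;> linarith [this.1, this.2]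

/-- Nonnegative vectors of small `ℓ¹`-norm can be colored in a balanced way
(a multicolor version of the theorem of Beck and Fiala). -/
theorem exists_balanced_coloring [NeZero m] {s : Finset C} {v : C → Fin m → ℝ} {Δ : ℝ}
    (hv : ∀ c ∈ s, ∀ i, 0 ≤ v c i) (hΔ : ∀ c ∈ s, ∑ i, v c i ≤ Δ) (hΔ0 : 0 ≤ Δ) :
    ∃ χ : C → Fin m, ∀ i j,
      |∑ c ∈ s with χ c = j, v c i - 1 / (m : ℝ) * ∑ c ∈ s, v c i| ≤ 2 * Δ := by
  have hm : (0 : ℝ) < m := Nat.cast_pos.2 (Nat.pos_of_neZero m)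
  have hm1 : (1 : ℝ) ≤ m := by exact_mod_cast Nat.pos_of_neZero m
  -- Rounding starts from the uniform assignment, which is perfectly balanced.
  obtain ⟨y, y1, y2, -, y4⟩ := exists_rounding hv hΔ hΔ0 (x := fun _ => 1 / (m : ℝ))
    (fun _ _ => ⟨by positivity, by rw [div_le_one hm]; exact hm1⟩)
    (fun _ _ => by simp [hm.ne'])
  have hex : ∀ c ∈ s, ∃ j, y (c, j) = 1 := by
    intro c hc
    by_contra! hcon
    have := y2 c hc
    rw [Finset.sum_eq_zero fun j _ => (y1 (c, j) hc).resolve_right (hcon j)] at this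
    exact zero_ne_one this
  choose! χ hχ using hex
  refine ⟨χ, fun i j => ?_⟩
  have h1 : ∀ c ∈ s, (if χ c = j then v c i else 0) = v c i * y (c, j) := by
    intro c hc
    split_ifs with h
    · rw [← h, hχ c hc, mul_one]
    · rcases y1 (c, j) hc with h0 | h0
      · rw [h0, mul_zero]
      · have h2 := Finset.add_le_sum (f := fun j => y (c, j)) (s := Finset.univ)
          (fun k _ => by rcases y1 (c, k) hc with h | h <;> simp [h])
          (Finset.mem_univ (χ c)) (Finset.mem_univ j) h
        rw [y2 c hc, hχ c hc, h0] at h2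
        norm_num at h2
  have h2 := y4 i j
  simp only [mul_sub, Finset.sum_sub_distrib] at h2
  rwa [Finset.sum_filter, Finset.sum_congr rfl h1, mul_comm, Finset.sum_mul]

end Rounding

/-! ### Perfect allocations -/

section Perfect

variable {m : ℕ}

/-- Starting at a point, agent `i` repeatedly cuts off a part of value `t`. -/
noncomputable def greedyCuts (i : Fin m) (t : unitInterval) :
    ℕ → unitInterval → Protocol (Fin m) (List ℝ)
  | 0, _ => Protocol.done []
  | k + 1, x => Protocol.cut i x t fun y => do
      let l ← greedyCuts i t k y
      return ((y : ℝ) :: l)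

/-- The greedy cuts of all agents in a list, starting at the left end of the cake. -/
noncomputable def allCuts (t : unitInterval) (N : ℕ) :
    List (Fin m) → Protocol (Fin m) (List ℝ)
  | [] => Protocol.done []
  | i :: l => do
      let c ← greedyCuts i t N 0
      let c' ← allCuts t N l
      return (c ++ c')

theorem cost_greedyCuts (V : Fin m → Valuation) (i : Fin m) (t : unitInterval) (N : ℕ)
    (x : unitInterval) : (greedyCuts i t N x).cost V = N := by
  induction N generalizing x with
  | zero => rfl
  | succ N ih => simp [greedyCuts, ih]

theorem length_greedyCuts (V : Fin m → Valuation) (i : Fin m) (t : unitInterval) (N : ℕ)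
    (x : unitInterval) : ((greedyCuts i t N x).run V).length = N := by
  induction N generalizing x with
  | zero => rfl
  | succ N ih => simp [greedyCuts, ih]

theorem cost_allCuts (V : Fin m → Valuation) (t : unitInterval) (N : ℕ) (l : List (Fin m)) :
    (allCuts t N l).cost V = l.length * N := by
  induction l with
  | nil => simp [allCuts]
  | cons i l ih => simp [allCuts, ih, cost_greedyCuts]; ring

theorem length_allCuts (V : Fin m → Valuation) (t : unitInterval) (N : ℕ) (l : List (Fin m)) :
    ((allCuts t N l).run V).length = l.length * N := by
  induction l with
  | nil => simp [allCuts]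
  | cons i l ih => simp [allCuts, ih, length_greedyCuts]; ring

theorem greedyCuts_subset_allCuts (V : Fin m → Valuation) (t : unitInterval) (N : ℕ)
    {l : List (Fin m)} {i : Fin m} (hi : i ∈ l) :
    (greedyCuts i t N 0).run V ⊆ (allCuts t N l).run V := by
  induction l with
  | nil => simp at hi
  | cons k l ih =>
    simp only [allCuts, Protocol.run_bind, Protocol.run_pure]
    rcases List.mem_cons.1 hi with rfl | hi
    · exact List.subset_append_left _ _
    · exact List.Subset.trans (ih hi) (List.subset_append_right _ _)

/-- An interval that avoids the greedy cuts has small value. -/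
theorem cdf_sub_le_of_greedyCuts (V : Fin m → Valuation) (i : Fin m) (t : unitInterval) (N : ℕ)
    {x : unitInterval} (hN : 1 - (V i).cdf x ≤ N * t) {l r : ℝ} (hl : x ≤ l)
    (hr : r ≤ 1) (hcut : ∀ y ∈ (greedyCuts i t N x).run V, ¬ (l < y ∧ y < r)) :
    (V i).cdf r - (V i).cdf l ≤ t := by
  induction N generalizing x with
  | zero =>
    have h1 := (V i).cdf_mono hl
    have h2 := (V i).cdf_mono hr
    rw [(V i).cdf_one] at h2
    push_cast at hN
    linarith [t.2.1]
  | succ N ih =>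
    simp only [greedyCuts, Protocol.run_cut, Protocol.run_bind, Protocol.run_pure] at hcut
    set y := (V i).cutAnswer x t with hy
    -- Either a part of value exactly `t` is cut off, or the cut is at `1` and nothing remains; in
    -- both cases `N` further cuts suffice.
    have hyx : (V i).cdf y - (V i).cdf x ≤ t ∧ 1 - (V i).cdf y ≤ N * t := by
      push_cast at hN
      rcases le_or_gt ((V i).cdf x + t) 1 with h | h
      · have := ((V i).cutAnswer_spec x t h).2.1
        rw [← hy] at this
        constructor <;> linarith
      · rw [hy, (V i).cutAnswer_eq_one x t h, Icc.coe_one, (V i).cdf_one, sub_self]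
        exact ⟨by linarith, mul_nonneg (Nat.cast_nonneg N) t.2.1⟩
    have hout := hcut y (by simp)
    -- An interval avoiding the cut `y` lies to its right, where the later cuts control it, or
    -- inside a part worth at most `t`.
    rcases le_or_gt (y : ℝ) l with h | h
    · exact ih hyx.2 h fun z hz => hcut z (by simp [hz])
    · have h1 : r ≤ y := by
        by_contra! h1; exact hout ⟨h, h1⟩
      have h2 := (V i).cdf_mono h1
      have h3 := (V i).cdf_mono hl
      linarith [hyx.1]

/-- A coloring of cells such that every agent gives every color class her value `1 / m` up to `δ`
according to the recorded values, if there is one. -/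
noncomputable def balancedColoring [NeZero m] (δ : ℝ) (R : List (Cell m)) : Cell m → Fin m :=
  Classical.epsilon fun χ => ∀ i j,
    |cellsValue i (R.filter fun c => decide (χ c = j)) - 1 / (m : ℝ)| ≤ δ

/-- Cut the cake into cells that every agent considers small, and distribute them in a balanced
way. -/
noncomputable def perfectProtocol (m : ℕ) [NeZero m] (δ : ℝ) (t : unitInterval) (N : ℕ) :
    Protocol (Fin m) (Fin m → Piece) := do
  let l ← allCuts t N (List.finRange m)
  let R ← splitAll l (wholeCake m)
  return fun j => cellsPiece (R.filter fun c => decide (balancedColoring δ R c = j))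

theorem IsResidue.nodup {V : Fin m → Valuation} {R : List (Cell m)} (h : IsResidue V R) :
    R.Nodup := by
  refine h.sorted.imp_of_mem fun {c c'} hc _ hcc => ?_
  rintro rfl
  exact absurd (h.correct c hc).lt (not_lt.2 hcc)

/-- The value vectors of the cells have `ℓ¹`-norm at most `m * t`, so a balanced coloring exists. It
is chosen from the recorded values alone, so no queries are needed. -/
theorem IsResidue.balancedColoring_spec [NeZero m] {V : Fin m → Valuation} {R : List (Cell m)}
    (h : IsResidue V R) (hR : ∀ i, cellsValue i R = 1) {t : ℝ} (ht : 0 ≤ t)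
    (hsmall : ∀ c ∈ R, ∀ i, c.known i ≤ t) {δ : ℝ} (hδ : 2 * (m * t) ≤ δ) (i j : Fin m) :
    |cellsValue i (R.filter fun c => decide (balancedColoring δ R c = j)) - 1 / (m : ℝ)| ≤ δ := by
  classical
  refine Classical.epsilon_spec (p := fun χ : Cell m → Fin m => ∀ i j,
    |cellsValue i (R.filter fun c => decide (χ c = j)) - 1 / (m : ℝ)| ≤ δ) ?_ i j
  have hnonneg : ∀ c ∈ R.toFinset, ∀ i, 0 ≤ c.known i := fun c hc i => by
    have hc' := h.correct c (List.mem_toFinset.1 hc)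
    rw [hc'.known]
    exact sub_nonneg.2 ((V i).cdf_mono hc'.lt.le)
  have hnorm : ∀ c ∈ R.toFinset, ∑ i, c.known i ≤ m * t := fun c hc => by
    have := Finset.sum_le_card_nsmul Finset.univ c.known t fun i _ =>
      hsmall c (List.mem_toFinset.1 hc) i
    simpa using this
  obtain ⟨χ, hχ⟩ := exists_balanced_coloring hnonneg hnorm (by positivity)
  refine ⟨χ, fun i j => ?_⟩
  have h1 := hχ i j
  rw [List.sum_toFinset _ h.nodup] at h1
  have h2 : ∑ c ∈ R.toFinset with χ c = j, c.known i =
      cellsValue i (R.filter fun c => decide (χ c = j)) := by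
    rw [cellsValue, ← List.sum_toFinset _ (h.nodup.filter _), List.toFinset_filter]
    simp
  rw [h2] at h1
  change |_ - 1 / (m : ℝ) * cellsValue i R| ≤ _ at h1
  rw [hR, mul_one] at h1
  exact h1.trans hδ

theorem perfectProtocol_spec [NeZero m] {δ : ℝ} {t : unitInterval} {N : ℕ}
    (hδ : 2 * (m * (t : ℝ)) ≤ δ) (hN : 1 ≤ N * (t : ℝ)) (V : Fin m → Valuation) :
    IsAllocation ((perfectProtocol m δ t N).run V) ∧
    IsComplete ((perfectProtocol m δ t N).run V) ∧
    IsPerfect δ V ((perfectProtocol m δ t N).run V) ∧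
    (perfectProtocol m δ t N).cost V ≤ m * N + m * N * m ∧
    ∑ j, ((perfectProtocol m δ t N).run V j).length ≤ 1 + m * N := by
  simp only [perfectProtocol, Protocol.run_bind, Protocol.run_pure, Protocol.cost_bind,
    Protocol.cost_pure, add_zero]
  have hlen := length_allCuts V t N (List.finRange m)
  have hsub : ∀ i, (greedyCuts i t N 0).run V ⊆ (allCuts t N (List.finRange m)).run V :=
    fun i => greedyCuts_subset_allCuts V t N (List.mem_finRange i)
  rw [cost_allCuts]
  rw [List.length_finRange] at hlen ⊢
  set l := (allCuts t N (List.finRange m)).run V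
  obtain ⟨hR, hcut⟩ := (isResidue_wholeCake V).splitAll_spec l
  have hcost := cost_splitAll_le V l (wholeCake m)
  have hlenR := length_splitAll_le V l (wholeCake m)
  set R := (splitAll l (wholeCake m)).run V
  have hval : ∀ i, cellsValue i R = 1 := fun i => by
    rw [hR.cellsValue_eq (isResidue_wholeCake V)]; simp [wholeCake]
  have hsmall : ∀ c ∈ R, ∀ i, c.known i ≤ t := by
    intro c hc i
    have hc' := hR.isResidue.correct c hc
    rw [hc'.known]
    exact cdf_sub_le_of_greedyCuts V i t N (x := 0) (by simp [(V i).cdf_zero, hN])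
      (by simpa using hc'.nonneg) hc'.le_one fun y hy => hcut y (hsub i hy) c hc
  refine ⟨⟨fun j => (hR.isResidue.isCells.sublist List.filter_sublist).wellFormed,
    fun j k hjk => hR.isResidue.isCells.disjoint_filter fun c _ h1 h2 => ?_⟩, ?_, fun i j => ?_,
    ?_, ?_⟩
  · simp only [decide_eq_true_eq] at h1 h2
    exact hjk (h1.symm.trans h2)
  · change (⋃ j, cellsSet (R.filter fun c => decide (balancedColoring δ R c = j))) = _
    rw [← cellsSet_wholeCake (m := m), ← hR.cellsSet_eq]
    ext x
    simp only [mem_iUnion, mem_cellsSet, List.mem_filter, decide_eq_true_eq]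
    exact ⟨fun ⟨_, c, hc, hx⟩ => ⟨c, hc.1, hx⟩, fun ⟨c, hc, hx⟩ => ⟨_, c, ⟨hc, rfl⟩, hx⟩⟩
  · change _ ≤ (V i).value (cellsSet _) ∧ (V i).value (cellsSet _) ≤ _
    rw [(hR.isResidue.isCells.sublist List.filter_sublist).value]
    have := abs_le.1 (hR.isResidue.balancedColoring_spec hval t.2.1 hsmall hδ i j)
    constructor <;> linarith [this.1, this.2]
  · rw [hlen] at hcost
    omega
  · rw [hlen] at hlenR
    refine le_trans (le_of_eq ?_) hlenR
    simp only [cellsPiece, List.length_map, ← List.countP_eq_length_filter]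
    clear hlenR hval hsmall hcost hcut hR
    generalize balancedColoring δ R = χ
    induction R with
    | nil => simp
    | cons c R ih => simp [List.countP_cons, Finset.sum_add_distrib, ih]

/-- With `t = δ/(2m)` the coloring error `2mt` is exactly `δ`, and `N = ⌈2m/δ⌉` cuts per agent
exhaust the cake. Since `m/δ ≥ 1` absorbs the rounding, `mN ≤ 3m²/δ`; making the cuts and recording
values costs at most `2m · mN`, which gives the constant `6`. -/
theorem exists_isPerfectSubroutine {δ : ℝ} (hm : 1 ≤ m) (hδ0 : 0 < δ) (hδ1 : δ ≤ 1) :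
    ∃ P : Protocol (Fin m) (Fin m → Piece), IsPerfectSubroutine 6 δ P := by
  have : NeZero m := ⟨by omega⟩
  have hm1 : (1 : ℝ) ≤ m := by exact_mod_cast hm
  have hm0 : (0 : ℝ) < m := by linarith
  have ht1 : δ / (2 * m) ≤ 1 := by rw [div_le_one (by positivity)]; linarith
  let t : unitInterval := ⟨δ / (2 * m), by positivity, ht1⟩
  have ht : (t : ℝ) = δ / (2 * m) := rfl
  set N : ℕ := ⌈2 * m / δ⌉₊ with hN
  have hN1 : 2 * m / δ ≤ N := Nat.le_ceil _
  have hN2 : (N : ℝ) ≤ 3 * (m / δ) := by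
    have h1 : (N : ℝ) < 2 * m / δ + 1 := Nat.ceil_lt_add_one (by positivity)
    have h2 : 1 ≤ m / δ := by rw [le_div_iff₀ hδ0]; linarith
    have h3 : 2 * m / δ = 2 * (m / δ) := by ring
    linarith
  refine ⟨perfectProtocol m δ t N, fun W => ?_⟩
  obtain ⟨h1, h2, h3, h4, h5⟩ := perfectProtocol_spec (m := m) (δ := δ) (t := t) (N := N)
    (by rw [ht]; exact le_of_eq (by field_simp))
    (by
      rw [ht]
      calc (1 : ℝ) = 2 * m / δ * (δ / (2 * m)) := by field_simp
        _ ≤ _ := mul_le_mul_of_nonneg_right hN1 (by positivity)) W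
  have h6 : (m : ℝ) * N ≤ 3 * (m ^ 2 / δ) := by
    calc (m : ℝ) * N ≤ m * (3 * (m / δ)) := mul_le_mul_of_nonneg_left hN2 hm0.le
      _ = _ := by ring
  refine ⟨h1, h2, h3, ?_, ?_⟩
  · have h7 : ((perfectProtocol m δ t N).cost W : ℝ) ≤ m * N + m * N * m := by exact_mod_cast h4
    have h8 := mul_le_mul_of_nonneg_right h6 hm0.le
    have h9 : (m : ℝ) * N ≤ m * N * m := le_mul_of_one_le_right (by positivity) hm1
    calc _ ≤ _ := h7
      _ ≤ 2 * (3 * ((m : ℝ) ^ 2 / δ) * m) := by linarith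
      _ = _ := by ring
  · have h7 : ((∑ j, ((perfectProtocol m δ t N).run W j).length : ℕ) : ℝ) ≤ 1 + m * N := by
      exact_mod_cast h5
    have h8 : 1 ≤ (m : ℝ) ^ 2 / δ := by
      rw [le_div_iff₀ hδ0]; nlinarith
    linarith

end Perfect

/-! ### The algorithm -/

theorem IsPerfect.isCLB {n : ℕ} {ε : ℝ} (hn : 0 < n) {V : Fin n → Valuation}
    {A : Fin n → Piece} (h : IsPerfect ε V A) (hp : IsProportional V A) (k : ℕ) :
    IsCLB (ε * n) k V A := by
  refine ⟨hp, fun S _ _ i _ => ?_⟩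
  have hn' : (0 : ℝ) < n := Nat.cast_pos.2 hn
  have h1 := Finset.sum_le_card_nsmul Sᶜ (fun j => (V i).value (Piece.toSet (A j))) _
    fun j _ => (h i j).2
  refine h1.trans (le_of_eq ?_)
  rw [Finset.card_compl, Fintype.card_fin, nsmul_eq_mul,
    Nat.cast_sub ((Finset.card_le_univ S).trans (Fintype.card_fin n).le)]
  field_simp

theorem mul_le_and_le_mul_of_sub_le {n : ℕ} {a : Fin n → ℝ} {s D : ℝ} (hs : ∑ j, a j = s)
    (hD : ∀ j k, a j - a k ≤ D) (j : Fin n) : n * a j ≤ s + n * D ∧ s - n * D ≤ n * a j := by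
  have h1 := Finset.sum_le_sum fun k (_ : k ∈ Finset.univ) => hD j k
  have h2 := Finset.sum_le_sum fun k (_ : k ∈ Finset.univ) => hD k j
  simp only [Finset.sum_sub_distrib, Finset.sum_const, Finset.card_univ, Fintype.card_fin,
    nsmul_eq_mul, hs] at h1 h2
  constructor <;> linarith

/-- The parameter conditions used by the two phases: `hlow` makes the residue outweigh the imbalance
of the pieces, so no piece exceeds `1/n`; `hupp` and `hδε` each take half of the allowed error `ε`.
-/
theorem algorithm_spec {n d : ℕ} {κ ε δ : ℝ} (hn : 2 ≤ n) (hδ : 0 < δ)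
    (hδ1 : δ < 1 / ((n + 1 : ℕ) : ℝ)) (hδ2 : 1 / ((n + 1 : ℕ) : ℝ) + δ ≤ 1 / 2)
    (hlow : 4 * n * δ ≤ (1 / ((n + 1 : ℕ) : ℝ) - δ) ^ d)
    (hupp : (1 / ((n + 1 : ℕ) : ℝ) + δ) ^ d ≤ ε / 2) (hδε : 4 * δ ≤ ε / 2)
    {P : Protocol (Fin (n + 1)) (Fin (n + 1) → Piece)} (hP : IsPerfectSubroutine κ δ P)
    (Vp : Valuation) {sel : (Fin n → ℝ) → Finset (Fin n) → Fin n} (hsel : IsSelector sel)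
    (V : Fin n → Valuation) :
    IsAllocation ((algorithm P d Vp sel).run V) ∧ IsComplete ((algorithm P d Vp sel).run V) ∧
    IsPerfect ε V ((algorithm P d Vp sel).run V) ∧
    IsProportional V ((algorithm P d Vp sel).run V) ∧
    ((algorithm P d Vp sel).cost V : ℝ) ≤
      d * (4 * (κ * (((n + 1 : ℕ) : ℝ) ^ 3 / δ))) + ((n - 1) * (2 * n + 1) : ℕ) := by
  have hn0 : (0 : ℝ) < n := Nat.cast_pos.2 (by omega)
  have hcost := Protocol.cost_answerLast_le V Vp
    (do let SR ← phaseOne P d (fun _ => []) (wholeCake (n + 1))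
        phaseTwo sel SR.1 (n - 1) Finset.univ Finset.univ SR.2)
  have hrun := Protocol.run_answerLast V Vp
    (do let SR ← phaseOne P d (fun _ => []) (wholeCake (n + 1))
        phaseTwo sel SR.1 (n - 1) Finset.univ Finset.univ SR.2)
  change ((algorithm P d Vp sel).cost V : ℕ) ≤ _ at hcost
  change (algorithm P d Vp sel).run V = _ at hrun
  rw [hrun]
  set V' := Protocol.withLast V Vp with hV'
  have hone : ∀ i, cellsValue i (wholeCake (n + 1)) = 1 := fun i => by simp [wholeCake]
  obtain ⟨h1, h2, h3, h4⟩ := (isPartialAllocation_wholeCake (V := V')).run_phaseOne hP hδ hδ1 hδ2 d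
    (fun i => by rw [hone]; exact one_pos)
  simp only [Protocol.run_bind, Protocol.cost_bind] at hcost ⊢
  set S := ((phaseOne P d (fun _ => []) (wholeCake (n + 1))).run V').1
  set R := ((phaseOne P d (fun _ => []) (wholeCake (n + 1))).run V').2
  have hcard : (Finset.univ : Finset (Fin n)).card = n - 1 + 1 := by
    rw [Finset.card_univ, Fintype.card_fin]; omega
  obtain ⟨-, g1, g2, g3, g4⟩ := hsel.run_phaseTwo h1.isCells h1.disjoint (n - 1) hcard hcard
    h1.isResidue h1.disjoint_residue
  have hcost2 := cost_phaseTwo_le V' sel S (n - 1) Finset.univ Finset.univ R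
  set A := (phaseTwo sel S (n - 1) Finset.univ Finset.univ R).run V'
  have hρ : ∀ i, 4 * n * δ ≤ cellsValue i R ∧ cellsValue i R ≤ ε / 2 := by
    intro i
    have := h2 i
    rw [hone, mul_one, mul_one] at this
    exact ⟨hlow.trans this.1, this.2.trans hupp⟩
  -- The pieces sum to `1 - ρ` and differ pairwise by at most `4δ`, so each is that close to their
  -- average.
  have hS : ∀ i j, n * cellsValue i (S j) ≤ 1 - cellsValue i R + n * (4 * δ) ∧
      1 - cellsValue i R - n * (4 * δ) ≤ n * cellsValue i (S j) := by
    intro i j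
    refine mul_le_and_le_mul_of_sub_le (eq_sub_of_add_eq (h1.sum_cellsValue i)) (fun j k => ?_) j
    have e1 := h3 i j k
    rw [cellsValue_nil, hone] at e1
    have e2 : 0 ≤ cellsValue i R := h1.isResidue.isCells.cellsValue_nonneg i
    nlinarith
  have hSle : ∀ i j, cellsValue i (S j) ≤ 1 / (n : ℝ) := by
    intro i j
    rw [le_div_iff₀ hn0]
    linarith [(hS i j).1, (hρ i).1]
  refine ⟨g1, ?_, fun i j => ?_, fun i => ?_, ?_⟩
  · rw [IsComplete, g2, ← h1.union_eq, union_comm]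
    simp
  · obtain ⟨k, -, hk1, hk2⟩ := g3 j (Finset.mem_univ j)
    have hVi : V i = V' i.castSucc := by rw [hV', Protocol.withLast_castSucc]
    rw [hVi]
    have e1 := (V' i.castSucc).value_mono hk1
    have e2 := (V' i.castSucc).value_mono hk2
    rw [(V' i.castSucc).value_union (h1.disjoint_residue k) (measurableSet_cellsSet R),
      h1.isResidue.isCells.value] at e2
    rw [(h1.isCells k).value] at e1 e2
    refine ⟨le_trans ?_ e1, e2.trans ?_⟩
    · have e3 := (hS i.castSucc k).2
      have e4 : (2 : ℝ) ≤ n := by exact_mod_cast hn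
      have e5 := (hρ i.castSucc).2
      have e6 : n * (1 / (n : ℝ) - ε) ≤ n * cellsValue i.castSucc (S k) := by
        have : n * (1 / (n : ℝ) - ε) = 1 - n * ε := by field_simp
        rw [this]
        nlinarith
      exact le_of_mul_le_mul_left e6 hn0
    · linarith [hSle i.castSucc k, (hρ i.castSucc).2]
  · have hVi : V i = V' i.castSucc := by rw [hV', Protocol.withLast_castSucc]
    rw [hVi]
    -- The invariant holds initially with equality: the whole cake is worth `n · (1/n)`.
    refine g4 (fun i _ => ⟨fun j _ => hSle _ j, ?_⟩) i (Finset.mem_univ i)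
    rw [add_comm (cellsValue _ R), h1.sum_cellsValue i.castSucc, Nat.cast_sub (by omega)]
    apply le_of_eq
    push_cast
    field_simp
    ring
  · have : ((algorithm P d Vp sel).cost V : ℝ) ≤
        ((phaseOne P d (fun _ => []) (wholeCake (n + 1))).cost V' : ℝ) +
          ((n - 1) * (2 * n + 1) : ℕ) := by
      exact_mod_cast hcost.trans (Nat.add_le_add_left hcost2 _)
    linarith

/-! ### The parameters -/

/-- The number of iterations of the first phase. -/
noncomputable def iterations (n : ℕ) (ε : ℝ) : ℕ := ⌈Real.log (4 / ε) / Real.log (n + 1)⌉₊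

/-- The accuracy of the perfect subroutine. -/
noncomputable def accuracy (n : ℕ) (ε : ℝ) : ℝ := ε / (64 * (n : ℝ) ^ 2)

section Parameters

variable {n : ℕ} {ε : ℝ}

theorem one_le_log_succ (hn : 2 ≤ n) : 1 ≤ Real.log (n + 1) := by
  have hn' : (2 : ℝ) ≤ n := by exact_mod_cast hn
  rw [Real.le_log_iff_exp_le (by linarith)]
  linarith [Real.exp_one_lt_d9]

theorem log_four_div_pos (hε : 0 < ε) (hε1 : ε ≤ 1) : 0 < Real.log (4 / ε) := by
  refine Real.log_pos ?_
  rw [lt_div_iff₀ hε]; linarith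

theorem iterations_bounds (hn : 2 ≤ n) (hε : 0 < ε) (hε1 : ε ≤ 1) :
    Real.log (4 / ε) ≤ iterations n ε * Real.log (n + 1) ∧
      iterations n ε * Real.log (n + 1) ≤ Real.log (4 / ε) + Real.log (n + 1) := by
  have h1 := one_le_log_succ hn
  have h0 : 0 < Real.log ((n : ℝ) + 1) := by linarith
  constructor
  · rw [← div_le_iff₀ h0]; exact Nat.le_ceil _
  · have h2 : (iterations n ε : ℝ) < Real.log (4 / ε) / Real.log (n + 1) + 1 :=
      Nat.ceil_lt_add_one (div_nonneg (log_four_div_pos hε hε1).le h0.le)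
    have h3 := mul_le_mul_of_nonneg_right h2.le h0.le
    rwa [add_mul, div_mul_cancel₀ _ h0.ne', one_mul] at h3

theorem pow_iterations (hn : 2 ≤ n) (hε : 0 < ε) (hε1 : ε ≤ 1) :
    4 / ε ≤ ((n : ℝ) + 1) ^ iterations n ε ∧
      ((n : ℝ) + 1) ^ iterations n ε ≤ 4 / ε * (n + 1) := by
  obtain ⟨h1, h2⟩ := iterations_bounds hn hε hε1
  have hn' : (0 : ℝ) < n + 1 := by positivity
  have hε' : 0 < 4 / ε := by positivity
  rw [← Real.log_pow] at h1 h2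
  rw [← Real.log_mul hε'.ne' hn'.ne'] at h2
  exact ⟨(Real.log_le_log_iff hε' (by positivity)).1 h1,
    (Real.log_le_log_iff (by positivity) (by positivity)).1 h2⟩

/-- The logarithms of `n` and `n + 1` differ by a factor of at most `2`; the `log 4` and the ceiling
add at most `3` to the ratio, which the maximum with `1` absorbs. -/
theorem iterations_theta (hn : 2 ≤ n) (hε : 0 < ε) (hε1 : ε ≤ 1) :
    1 / 2 * max 1 (Real.log (1 / ε) / Real.log n) ≤ iterations n ε ∧
      (iterations n ε : ℝ) ≤ 4 * max 1 (Real.log (1 / ε) / Real.log n) := by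
  have hn' : (2 : ℝ) ≤ n := by exact_mod_cast hn
  have hlogn : 0 < Real.log n := Real.log_pos (by linarith)
  have hlogn1 := one_le_log_succ hn
  have hle : Real.log n ≤ Real.log (n + 1) := Real.log_le_log (by linarith) (by linarith)
  have hle2 : Real.log (n + 1) ≤ 2 * Real.log n := by
    have : 2 * Real.log (n : ℝ) = Real.log ((n : ℝ) ^ 2) := by rw [Real.log_pow]; norm_num
    rw [this]
    exact Real.log_le_log (by linarith) (by nlinarith)
  have hlog4 : Real.log (4 / ε) = Real.log 4 + Real.log (1 / ε) := by
    rw [← Real.log_mul (by norm_num) (by positivity)]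
    ring_nf
  have h4 : 0 ≤ Real.log 4 := Real.log_nonneg (by norm_num)
  have h4' : Real.log 4 ≤ 2 * Real.log n := by
    have : (4 : ℝ) = 2 ^ 2 := by norm_num
    rw [this, Real.log_pow]
    have := Real.log_le_log (by norm_num) hn'
    push_cast
    linarith
  have hε2 : 0 ≤ Real.log (1 / ε) := Real.log_nonneg (by rw [le_div_iff₀ hε]; linarith)
  obtain ⟨h1, h2⟩ := iterations_bounds hn hε hε1
  set X := Real.log (1 / ε) / Real.log n with hX
  have hXn : X * Real.log n = Real.log (1 / ε) := div_mul_cancel₀ _ hlogn.ne'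
  have hX0 : 0 ≤ X := div_nonneg hε2 hlogn.le
  have hpos : 1 ≤ (iterations n ε : ℝ) := by
    exact_mod_cast Nat.ceil_pos.2 (div_pos (log_four_div_pos hε hε1) (by linarith))
  constructor
  · have h3 : X ≤ 2 * iterations n ε := by
      have h5 : X * Real.log n ≤ 2 * iterations n ε * Real.log n := by
        have := mul_le_mul_of_nonneg_left hle2 (Nat.cast_nonneg (α := ℝ) (iterations n ε))
        linarith
      exact le_of_mul_le_mul_right h5 hlogn
    have := max_le (by linarith : (1 : ℝ) ≤ 2 * iterations n ε) h3
    linarith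
  · have h3 : (iterations n ε : ℝ) ≤ X + 3 := by
      have h5 : (iterations n ε : ℝ) * Real.log (n + 1) ≤ (X + 3) * Real.log (n + 1) := by
        have := mul_le_mul_of_nonneg_left hle hX0
        linarith
      exact le_of_mul_le_mul_right h5 (by linarith)
    linarith [le_max_left 1 X, le_max_right 1 X]

theorem accuracy_pos (hn : 2 ≤ n) (hε : 0 < ε) : 0 < accuracy n ε := by
  have : (0 : ℝ) < n := Nat.cast_pos.2 (by omega)
  unfold accuracy; positivity

/-- The accumulated relative error of all iterations is bounded, because `d ≤ 4/ε` already follows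
from `log x ≤ x - 1`. -/
theorem iterations_mul_le (hn : 2 ≤ n) (hε : 0 < ε) (hε1 : ε ≤ 1) :
    iterations n ε * (((n : ℝ) + 1) * accuracy n ε) ≤ 1 / 2 := by
  have hn' : (2 : ℝ) ≤ n := by exact_mod_cast hn
  obtain ⟨-, h2⟩ := iterations_bounds hn hε hε1
  have h1 := one_le_log_succ hn
  have h3 : (iterations n ε : ℝ) ≤ 4 / ε := by
    have h4 := Real.log_le_sub_one_of_pos (show (0 : ℝ) < 4 / ε by positivity)
    have h5 : (iterations n ε : ℝ) * Real.log (n + 1) ≤ 4 / ε * Real.log (n + 1) := by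
      have : 1 ≤ 4 / ε := by rw [le_div_iff₀ hε]; linarith
      nlinarith
    exact le_of_mul_le_mul_right h5 (by linarith)
  refine (mul_le_mul_of_nonneg_right h3
    (mul_nonneg (by positivity) (accuracy_pos hn hε).le)).trans ?_
  have h6 : 4 / ε * (((n : ℝ) + 1) * accuracy n ε) = (n + 1) / (16 * n ^ 2) := by
    unfold accuracy; field_simp; norm_num
  rw [h6, div_le_iff₀ (by positivity)]
  nlinarith

theorem residue_bounds (hn : 2 ≤ n) (hε : 0 < ε) (hε1 : ε ≤ 1) :
    4 * n * accuracy n ε ≤ (1 / ((n + 1 : ℕ) : ℝ) - accuracy n ε) ^ iterations n ε ∧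
      (1 / ((n + 1 : ℕ) : ℝ) + accuracy n ε) ^ iterations n ε ≤ ε / 2 := by
  have hn' : (2 : ℝ) ≤ n := by exact_mod_cast hn
  have hδ := accuracy_pos hn hε
  obtain ⟨h1, h2⟩ := pow_iterations hn hε hε1
  have h3 := iterations_mul_le hn hε hε1
  set η := ((n : ℝ) + 1) * accuracy n ε with hη
  have hη0 : 0 < η := by positivity
  have hη1 : η ≤ 1 := by
    have : η = ε * (n + 1) / (64 * n ^ 2) := by rw [hη, accuracy]; ring
    rw [this, div_le_one (by positivity)]
    nlinarith
  have e1 : 1 / ((n + 1 : ℕ) : ℝ) - accuracy n ε = (1 - η) / (n + 1) := by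
    rw [hη]; push_cast; field_simp
  have e2 : 1 / ((n + 1 : ℕ) : ℝ) + accuracy n ε = (1 + η) / (n + 1) := by
    rw [hη]; push_cast; field_simp
  -- Bernoulli's inequality with `dη ≤ 1/2`. The upper bound below follows from it, since `(1 + η)(1
  -- - η) ≤ 1`.
  have h4 : 1 / 2 ≤ (1 - η) ^ iterations n ε := by
    have := one_add_mul_le_pow (show -2 ≤ -η by linarith) (iterations n ε)
    rw [← sub_eq_add_neg 1 η] at this
    linarith
  have h5 : (1 + η) ^ iterations n ε ≤ 2 := by
    have h6 : (1 + η) ^ iterations n ε * (1 - η) ^ iterations n ε ≤ 1 := by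
      rw [← mul_pow]
      exact pow_le_one₀ (mul_nonneg (by linarith) (by linarith)) (by nlinarith)
    have h7 : 0 ≤ (1 + η) ^ iterations n ε := by positivity
    nlinarith
  rw [e1, e2, div_pow, div_pow]
  constructor
  · rw [le_div_iff₀ (by positivity)]
    refine le_trans ?_ h4
    refine (mul_le_mul_of_nonneg_left h2 (by positivity)).trans ?_
    -- The factor `64` in `accuracy` makes this `(n + 1)/(4n)`, which is at most `1/2`.
    have h6 : 4 * n * accuracy n ε * (4 / ε * ((n : ℝ) + 1)) = (n + 1) / (4 * n) := by
      unfold accuracy; field_simp; norm_num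
    rw [h6, div_le_iff₀ (by positivity)]
    linarith
  · rw [div_le_iff₀ (by positivity)]
    refine h5.trans ?_
    have h6 := mul_le_mul_of_nonneg_left h1 (show 0 ≤ ε / 2 by positivity)
    have h7 : ε / 2 * (4 / ε) = 2 := by field_simp; norm_num
    linarith

theorem accuracy_bounds (hn : 2 ≤ n) (hε : 0 < ε) (hε1 : ε ≤ 1) :
    accuracy n ε < 1 / ((n + 1 : ℕ) : ℝ) ∧ 1 / ((n + 1 : ℕ) : ℝ) + accuracy n ε ≤ 1 / 2 ∧
      4 * accuracy n ε ≤ ε / 2 := by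
  have hn' : (2 : ℝ) ≤ n := by exact_mod_cast hn
  have h1 : accuracy n ε ≤ ε / 256 := by
    unfold accuracy
    exact div_le_div_of_nonneg_left hε.le (by norm_num) (by nlinarith)
  have h2 : 1 / ((n + 1 : ℕ) : ℝ) ≤ 1 / 3 := by
    push_cast
    exact div_le_div_of_nonneg_left zero_le_one (by norm_num) (by linarith)
  refine ⟨?_, by linarith, by linarith⟩
  unfold accuracy
  push_cast
  rw [div_lt_div_iff₀ (by positivity) (by positivity)]
  nlinarith

end Parameters

/-! ### Concrete choices of tie-breaking and extra valuation, and the final bounds -/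

theorem exists_isSelector {n : ℕ} (hn : 0 < n) :
    ∃ sel : (Fin n → ℝ) → Finset (Fin n) → Fin n, IsSelector sel := by
  have : ∀ (f : Fin n → ℝ) (T : Finset (Fin n)),
      ∃ i, T.Nonempty → i ∈ T ∧ ∀ j ∈ T, f i ≤ f j := by
    intro f T
    by_cases hT : T.Nonempty
    · obtain ⟨i, hi, hmin⟩ := T.exists_min_image f hT
      exact ⟨i, fun _ => ⟨hi, hmin⟩⟩
    · exact ⟨⟨0, hn⟩, fun h => absurd h hT⟩
  choose sel hsel using this
  exact ⟨sel, hsel⟩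

/-- The valuation given by length. -/
noncomputable def uniformValuation : Valuation where
  measure := volume.restrict (Icc 0 1)
  nonatomic := inferInstance
  normalized := by simp
  supported := by rw [Measure.restrict_apply measurableSet_Icc.compl]; simp

/-- The guarantees of the algorithm with the chosen parameters. -/
theorem algorithm_guarantees {κ ε : ℝ} {n : ℕ} (hn : 2 ≤ n) (hε : 0 < ε) (hε1 : ε ≤ 1)
    {P : Protocol (Fin (n + 1)) (Fin (n + 1) → Piece)}
    (hP : IsPerfectSubroutine κ (accuracy n ε) P) (Vp : Valuation)
    {sel : (Fin n → ℝ) → Finset (Fin n) → Fin n} (hsel : IsSelector sel)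
    (V : Fin n → Valuation) :
    IsAllocation ((algorithm P (iterations n ε) Vp sel).run V) ∧
    IsComplete ((algorithm P (iterations n ε) Vp sel).run V) ∧
    IsPerfect ε V ((algorithm P (iterations n ε) Vp sel).run V) ∧
    IsProportional V ((algorithm P (iterations n ε) Vp sel).run V) ∧
    IsCLB (ε * n) n V ((algorithm P (iterations n ε) Vp sel).run V) ∧
    ((algorithm P (iterations n ε) Vp sel).cost V : ℝ) ≤
      (4096 * |κ| + 2) * ((n : ℝ) ^ 5 / ε * max 1 (Real.log (1 / ε) / Real.log n)) := by
  obtain ⟨a1, a2, a3⟩ := accuracy_bounds hn hε hε1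
  obtain ⟨b1, b2⟩ := residue_bounds hn hε hε1
  obtain ⟨h1, h2, h3, h4, h5⟩ := algorithm_spec hn (accuracy_pos hn hε) a1 a2 b1 b2 a3 hP Vp hsel V
  refine ⟨h1, h2, h3, h4, h3.isCLB (by omega) h4 n, h5.trans ?_⟩
  have hn' : (2 : ℝ) ≤ n := by exact_mod_cast hn
  have hd := (iterations_theta hn hε hε1).2
  set L := max 1 (Real.log (1 / ε) / Real.log n)
  have hL : 1 ≤ L := le_max_left _ _
  -- The constant is `256 = 4 · 64`, from `(n+1)³ ≤ 4n³` and the denominator of `accuracy`. With `d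
  -- ≤ 4L` and the factor `4` per iteration it yields `4096`; the remaining `2` pays for the second
  -- phase.
  have c1 : ((n + 1 : ℕ) : ℝ) ^ 3 / accuracy n ε ≤ 256 * ((n : ℝ) ^ 5 / ε) := by
    have e1 : ((n + 1 : ℕ) : ℝ) ^ 3 ≤ 4 * (n : ℝ) ^ 3 := by
      push_cast
      have : ((n : ℝ) + 1) ^ 3 ≤ (3 / 2 * n) ^ 3 :=
        pow_le_pow_left₀ (by positivity) (by linarith) 3
      have h0 : (0 : ℝ) ≤ (n : ℝ) ^ 3 := by positivity
      have e2 : (3 / 2 * (n : ℝ)) ^ 3 = 27 / 8 * (n : ℝ) ^ 3 := by ring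
      linarith
    calc _ ≤ 4 * (n : ℝ) ^ 3 / accuracy n ε :=
          div_le_div_of_nonneg_right e1 (accuracy_pos hn hε).le
      _ = _ := by unfold accuracy; field_simp; norm_num
  have c2 : κ * (((n + 1 : ℕ) : ℝ) ^ 3 / accuracy n ε) ≤ |κ| * (256 * ((n : ℝ) ^ 5 / ε)) :=
    (mul_le_mul_of_nonneg_right (le_abs_self κ)
      (div_nonneg (by positivity) (accuracy_pos hn hε).le)).trans
      (mul_le_mul_of_nonneg_left c1 (abs_nonneg κ))
  have c3 : (iterations n ε : ℝ) * (4 * (κ * (((n + 1 : ℕ) : ℝ) ^ 3 / accuracy n ε))) ≤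
      4 * L * (4 * (|κ| * (256 * ((n : ℝ) ^ 5 / ε)))) :=
    (mul_le_mul_of_nonneg_left (mul_le_mul_of_nonneg_left c2 (by norm_num))
      (Nat.cast_nonneg _)).trans (mul_le_mul_of_nonneg_right hd (by positivity))
  have c4 : (((n - 1) * (2 * n + 1) : ℕ) : ℝ) ≤ 2 * ((n : ℝ) ^ 5 / ε * L) := by
    have e1 : (((n - 1) * (2 * n + 1) : ℕ) : ℝ) ≤ 2 * (n : ℝ) ^ 2 := by
      rw [Nat.cast_mul, Nat.cast_sub (by omega)]
      push_cast
      nlinarith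
    have e2 : (n : ℝ) ^ 2 ≤ (n : ℝ) ^ 5 := pow_le_pow_right₀ (by linarith) (by norm_num)
    have e3 : (n : ℝ) ^ 5 ≤ (n : ℝ) ^ 5 / ε := le_div_self (by positivity) hε hε1
    have e4 : (n : ℝ) ^ 5 / ε ≤ (n : ℝ) ^ 5 / ε * L := le_mul_of_one_le_right (by positivity) hL
    linarith
  calc _ ≤ _ := add_le_add c3 c4
    _ = _ := by ring

end CakeCutting

theorem mainTheorem4 :
    -- perfect subroutines with an absolute constant exist
    (∃ κ : ℝ, ∀ (m : ℕ) (δ : ℝ), 1 ≤ m → 0 < δ → δ ≤ 1 →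
      ∃ P : CakeCutting.Protocol (Fin m) (Fin m → CakeCutting.Piece),
        CakeCutting.IsPerfectSubroutine κ δ P) ∧
    -- parameters, and what the algorithm achieves with any such subroutine
    (∃ (d : ℕ → ℝ → ℕ) (ε' : ℕ → ℝ → ℝ),
      (∃ a b : ℝ, 0 < a ∧ 0 < b ∧ ∀ (n : ℕ) (ε : ℝ), 2 ≤ n → 0 < ε → ε ≤ 1 →
        a * max 1 (Real.log (1 / ε) / Real.log n) ≤ d n ε ∧
        (d n ε : ℝ) ≤ b * max 1 (Real.log (1 / ε) / Real.log n) ∧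
        a * (ε / (n : ℝ) ^ 2) ≤ ε' n ε ∧ ε' n ε ≤ b * (ε / (n : ℝ) ^ 2) ∧ ε' n ε ≤ 1) ∧
      ∀ κ : ℝ, ∃ K : ℝ, ∀ (n : ℕ) (ε : ℝ), 2 ≤ n → 0 < ε → ε ≤ 1 →
        ∀ P : CakeCutting.Protocol (Fin (n + 1)) (Fin (n + 1) → CakeCutting.Piece),
          CakeCutting.IsPerfectSubroutine κ (ε' n ε) P →
        ∀ (Vp : CakeCutting.Valuation) (sel : (Fin n → ℝ) → Finset (Fin n) → Fin n),
          CakeCutting.IsSelector sel →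
        ∀ V : Fin n → CakeCutting.Valuation,
          CakeCutting.IsAllocation ((CakeCutting.algorithm P (d n ε) Vp sel).run V) ∧
          CakeCutting.IsComplete ((CakeCutting.algorithm P (d n ε) Vp sel).run V) ∧
          CakeCutting.IsPerfect ε V ((CakeCutting.algorithm P (d n ε) Vp sel).run V) ∧
          CakeCutting.IsProportional V ((CakeCutting.algorithm P (d n ε) Vp sel).run V) ∧
          CakeCutting.IsCLB (ε * n) n V ((CakeCutting.algorithm P (d n ε) Vp sel).run V) ∧
          ((CakeCutting.algorithm P (d n ε) Vp sel).cost V : ℝ) ≤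
            K * ((n : ℝ) ^ 5 / ε * max 1 (Real.log (1 / ε) / Real.log n))) ∧
    -- hence complete approximately CLB allocations with a bounded number of queries
    (∃ K : ℝ, ∀ (n : ℕ) (δ : ℝ), 2 ≤ n → 0 < δ → δ ≤ 1 →
      ∃ Q : CakeCutting.Protocol (Fin n) (Fin n → CakeCutting.Piece),
        ∀ V : Fin n → CakeCutting.Valuation,
          CakeCutting.IsAllocation (Q.run V) ∧ CakeCutting.IsComplete (Q.run V) ∧
          CakeCutting.IsCLB δ n V (Q.run V) ∧
          (Q.cost V : ℝ) ≤ K * ((n : ℝ) ^ 6 / δ * (Real.log (n / δ) / Real.log n))) := by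
  refine ⟨⟨6, fun m δ hm hδ hδ1 => CakeCutting.exists_isPerfectSubroutine hm hδ hδ1⟩,
    ⟨CakeCutting.iterations, CakeCutting.accuracy, ⟨1 / 64, 4, by norm_num, by norm_num,
      fun n ε hn hε hε1 => ?_⟩, fun κ => ⟨4096 * |κ| + 2, fun n ε hn hε hε1 P hP Vp sel hsel V =>
        CakeCutting.algorithm_guarantees hn hε hε1 hP Vp hsel V⟩⟩,
    ⟨4096 * |6| + 2, fun n δ hn hδ hδ1 => ?_⟩⟩
  · have hn0 : (0 : ℝ) < n := Nat.cast_pos.2 (by omega)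
    obtain ⟨h1, h2⟩ := CakeCutting.iterations_theta hn hε hε1
    obtain ⟨-, -, h3⟩ := CakeCutting.accuracy_bounds hn hε hε1
    have hL : 1 ≤ max 1 (Real.log (1 / ε) / Real.log n) := le_max_left _ _
    have h4 : CakeCutting.accuracy n ε = 1 / 64 * (ε / (n : ℝ) ^ 2) := by
      rw [CakeCutting.accuracy]; field_simp
    have h5 : 0 < ε / (n : ℝ) ^ 2 := by positivity
    exact ⟨by linarith, h2, h4.ge, by linarith, by linarith⟩
  · have hn1 : (1 : ℝ) ≤ n := by exact_mod_cast (by omega : 1 ≤ n)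
    have hn2 : (2 : ℝ) ≤ n := by exact_mod_cast hn
    have hn0 : (0 : ℝ) < n := by linarith
    -- With `ε = δ/n` the CLB error `εn` is `δ`, and `n⁵/ε` becomes `n⁶/δ`.
    have hε : 0 < δ / n := by positivity
    have hε1 : δ / n ≤ 1 := by rw [div_le_one hn0]; linarith
    obtain ⟨-, -, ha⟩ := CakeCutting.accuracy_bounds hn hε hε1
    obtain ⟨P, hP⟩ := CakeCutting.exists_isPerfectSubroutine (m := n + 1) (by omega)
      (CakeCutting.accuracy_pos hn hε) (by linarith)
    obtain ⟨sel, hsel⟩ := CakeCutting.exists_isSelector (n := n) (by omega)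
    refine ⟨CakeCutting.algorithm P (CakeCutting.iterations n (δ / n))
      CakeCutting.uniformValuation sel, fun V => ?_⟩
    obtain ⟨h1, h2, -, -, h3, h4⟩ := CakeCutting.algorithm_guarantees hn hε hε1 hP
      CakeCutting.uniformValuation hsel V
    rw [div_mul_cancel₀ _ hn0.ne'] at h3
    refine ⟨h1, h2, h3, h4.trans (le_of_eq ?_)⟩
    -- As `δ ≤ 1`, the ratio of logarithms is at least `1`, so the maximum disappears.
    have hlog : 1 ≤ Real.log (n / δ) / Real.log n := by
      rw [le_div_iff₀ (Real.log_pos (by linarith)), one_mul]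
      exact Real.log_le_log hn0 (le_div_self hn0.le hδ hδ1)
    rw [one_div_div, max_eq_right hlog]
    congr 2
    field_simp
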